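/- Let $\mathcal G\rightrightarrows M$ be a Lie groupoid with source $s$, target $t$ and units $u:M\to\mathcal G$, $u(x)=1_x$, where $M$ and $\mathcal G$ are smooth finite-dimensional manifolds without boundary and $\mathcal G$ is Hausdorff, and suppose that all fibres $s^{-1}(x)$, $x\in M$, are connected. Let $A$ be its Lie algebroid: $A_x=\ker(d_{1_x}s)\subset T_{1_x}\mathcal G$, the anchor is $\rho=dt|_A$, and the bracket on $\Gamma(A)$ is obtained by identifying a section $X$ of $A$ with the right invariant vector field $X^R$ on $\mathcal G$ extending it. Let $I\subset A$ be an ideal, i.e. a smooth vector subbundle with $\rho(I)=0$ such that $\Gamma(I)$ is an ideal of the Lie algebra $\Gamma(A)$. Then the representation $\nabla_XY=[X,Y]$ of $A$ on $I$ ($X\in\Gamma(A)$, $Y\in\Gamma(I)$) integrates to $\mathcal G$. That is, there is a representation of $\mathcal G$ on $I$ (linear maps $I_{s(g)}\to I_{t(g)}$, $v\mapsto g\cdot v$, with $1_x\cdot v=v$ and $(gh)\cdot v=g\cdot(h\cdot v)$, depending smoothly on $g\in\mathcal G$) such that for all smooth sections $X\in\Gamma(A)$, $Y\in\Gamma(I)$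 and all $x\in M$, \[ \frac{d}{d\tau}\Big|_{\tau=0}\ \gamma(\tau)^{-1}\cdot Y_{t(\gamma(\tau))}=[X,Y]_x , \] where $\gamma$ is the integral curve of $X^R$ with $\gamma(0)=1_x$ (it lies in $s^{-1}(x)$). -/

import Mathlib

open Set Topology
open scoped Manifold ContDiff

/-- A Lie groupoid `G ⇉ M` over manifolds `M`, `G` (without boundary, modelled on the
finite-dimensional real vector spaces `EM`, `EG`).  An arrow `g` goes from `src g` to `tgt g`, and
`mul g h` is the product `g h`, meaningful only if `src g = tgt h`; the values of `mul` on
non-composable pairs are irrelevant.  Smoothness of the multiplication is smoothness on the set of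
composable pairs, which is an embedded submanifold of `G × G`. -/
structure LieGroupoid (EM : Type*) [NormedAddCommGroup EM] [NormedSpace ℝ EM]
    (EG : Type*) [NormedAddCommGroup EG] [NormedSpace ℝ EG]
    (M : Type*) [TopologicalSpace M] [ChartedSpace EM M] [IsManifold 𝓘(ℝ, EM) ∞ M]
    (G : Type*) [TopologicalSpace G] [ChartedSpace EG G] [IsManifold 𝓘(ℝ, EG) ∞ G] where
  src : G → M
  tgt : G → M
  unit : M → G
  inv : G → G
  mul : G → G → G
  src_unit : ∀ x, src (unit x) = x
  tgt_unit : ∀ x, tgt (unit x) = x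
  src_inv : ∀ g, src (inv g) = tgt g
  tgt_inv : ∀ g, tgt (inv g) = src g
  src_mul : ∀ g h, src g = tgt h → src (mul g h) = src h
  tgt_mul : ∀ g h, src g = tgt h → tgt (mul g h) = tgt g
  mul_assoc : ∀ g h k, src g = tgt h → src h = tgt k → mul (mul g h) k = mul g (mul h k)
  unit_mul : ∀ g, mul (unit (tgt g)) g = g
  mul_unit : ∀ g, mul g (unit (src g)) = g
  inv_mul : ∀ g, mul (inv g) g = unit (src g)
  mul_inv : ∀ g, mul g (inv g) = unit (tgt g)
  src_submersion : Manifold.IsSubmersion 𝓘(ℝ, EG) 𝓘(ℝ, EM) ∞ src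
  tgt_submersion : Manifold.IsSubmersion 𝓘(ℝ, EG) 𝓘(ℝ, EM) ∞ tgt
  smooth_unit : ContMDiff 𝓘(ℝ, EM) 𝓘(ℝ, EG) ∞ unit
  smooth_inv : ContMDiff 𝓘(ℝ, EG) 𝓘(ℝ, EG) ∞ inv
  smooth_mul : ContMDiffOn (𝓘(ℝ, EG).prod 𝓘(ℝ, EG)) 𝓘(ℝ, EG) ∞
    (fun p : G × G => mul p.1 p.2) {p | src p.1 = tgt p.2}

namespace LieGroupoid

variable {EM : Type*} [NormedAddCommGroup EM] [NormedSpace ℝ EM]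
  {EG : Type*} [NormedAddCommGroup EG] [NormedSpace ℝ EG]
  {M : Type*} [TopologicalSpace M] [ChartedSpace EM M] [IsManifold 𝓘(ℝ, EM) ∞ M]
  {G : Type*} [TopologicalSpace G] [ChartedSpace EG G] [IsManifold 𝓘(ℝ, EG) ∞ G]

/-- The tangent space of `G` at the unit over `x`. -/
abbrev UnitTangent (Γ : LieGroupoid EM EG M G) (x : M) : Type _ :=
  TangentSpace 𝓘(ℝ, EG) (Γ.unit x)

/-- The fibre at `x` of the Lie algebroid `A` of the groupoid: the vectors at the unit over `x`
that are tangent to the source fibre. -/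
noncomputable def algebroid (Γ : LieGroupoid EM EG M G) (x : M) : Submodule ℝ (Γ.UnitTangent x) :=
  LinearMap.ker (mfderiv 𝓘(ℝ, EG) 𝓘(ℝ, EM) Γ.src (Γ.unit x)).toLinearMap

/-- The anchor `ρ` of `A`: the differential of the target map. -/
noncomputable def anchor (Γ : LieGroupoid EM EG M G) (x : M) :
    Γ.algebroid x →ₗ[ℝ] TangentSpace 𝓘(ℝ, EM) (Γ.tgt (Γ.unit x)) :=
  (mfderiv 𝓘(ℝ, EG) 𝓘(ℝ, EM) Γ.tgt (Γ.unit x)).toLinearMap.comp (Γ.algebroid x).subtype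

/-- Smoothness on `U ⊆ M` of a section `X` of the pullback of `TG` along the unit map.
A section of a smooth subbundle is smooth iff it is smooth as a section of the ambient bundle. -/
def SmoothOn (Γ : LieGroupoid EM EG M G) (X : ∀ x, Γ.UnitTangent x) (U : Set M) : Prop :=
  ContMDiffOn 𝓘(ℝ, EM) 𝓘(ℝ, EG).tangent ∞
    (fun x => (⟨Γ.unit x, X x⟩ : TangentBundle 𝓘(ℝ, EG) G)) U

/-- The right invariant vector field on `G` of a section `X` of `A`: its value at `g` is
`d(R_g) (X (tgt g))`, where `R_g h = h g` is right translation, defined on the source fibre over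
`tgt g`.  The derivative is taken within this fibre; on vectors tangent to the fibre (an embedded
submanifold) it is the differential of `R_g`.  It is a vector at `1 g = g`. -/
noncomputable def rightInvariant (Γ : LieGroupoid EM EG M G) (X : ∀ x, Γ.UnitTangent x) (g : G) :
    TangentSpace 𝓘(ℝ, EG) g :=
  show TangentSpace 𝓘(ℝ, EG) (Γ.mul (Γ.unit (Γ.tgt g)) g) from
    mfderivWithin 𝓘(ℝ, EG) 𝓘(ℝ, EG) (fun h => Γ.mul h g) (Γ.src ⁻¹' {Γ.tgt g})
      (Γ.unit (Γ.tgt g)) (X (Γ.tgt g))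

/-- The Lie bracket of sections of `A`: the commutator of the corresponding right invariant vector
fields, restricted to the units. -/
noncomputable def bracket (Γ : LieGroupoid EM EG M G) (X Y : ∀ x, Γ.UnitTangent x) (x : M) :
    Γ.UnitTangent x :=
  VectorField.mlieBracket 𝓘(ℝ, EG) (Γ.rightInvariant X) (Γ.rightInvariant Y) (Γ.unit x)

/-- `V ⊆ u^* TG` is a smooth vector subbundle: near every point it has a smooth frame. -/
def IsSubbundle (Γ : LieGroupoid EM EG M G) (V : ∀ x, Submodule ℝ (Γ.UnitTangent x)) : Prop :=
  ∀ x₀, ∃ U : Set M, IsOpen U ∧ x₀ ∈ U ∧ ∃ (k : ℕ) (e : Fin k → ∀ x, Γ.UnitTangent x),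
    (∀ i, Γ.SmoothOn (e i) U) ∧
    ∀ x ∈ U, LinearIndependent ℝ (fun i => e i x) ∧ Submodule.span ℝ (range fun i => e i x) = V x

/-- An ideal of `A`: a subbundle `V ⊆ A` with `ρ(V) = 0` such that the smooth sections of `V`
form an ideal of the Lie algebra of smooth sections of `A`. -/
structure IsIdeal (Γ : LieGroupoid EM EG M G) (V : ∀ x, Submodule ℝ (Γ.UnitTangent x)) :
    Prop where
  subbundle : Γ.IsSubbundle V
  le_algebroid : ∀ x, V x ≤ Γ.algebroid x
  anchor_eq_zero : ∀ x (v : Γ.algebroid x), (v : Γ.UnitTangent x) ∈ V x → Γ.anchor x v = 0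
  bracket_mem : ∀ X Y : ∀ x, Γ.UnitTangent x,
    Γ.SmoothOn X univ → (∀ x, X x ∈ Γ.algebroid x) →
    Γ.SmoothOn Y univ → (∀ x, Y x ∈ V x) → ∀ x, Γ.bracket X Y x ∈ V x

/-- A representation of the Lie groupoid on a vector subbundle `V ⊆ u^* TG`: each arrow `g` from
`x` to `y` acts by a linear map `V x → V y`, functorially, and the action is smooth.  Smoothness of
the action map `(g, v) ↦ g v` on `G ×_M V` is expressed on local smooth sections `Y` of `V`:
`g ↦ g (Y (src g))` is smooth; for local frames this is smoothness of the matrix entries. -/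
structure Representation (Γ : LieGroupoid EM EG M G)
    (V : ∀ x, Submodule ℝ (Γ.UnitTangent x)) where
  act : ∀ {x y : M} (g : G), Γ.src g = x → Γ.tgt g = y → (V x →ₗ[ℝ] V y)
  act_unit : ∀ x, act (Γ.unit x) (Γ.src_unit x) (Γ.tgt_unit x) = LinearMap.id
  act_mul : ∀ {x y z : M} (g h : G) (hgs : Γ.src g = y) (hgt : Γ.tgt g = z)
    (hhs : Γ.src h = x) (hht : Γ.tgt h = y),
    act (Γ.mul g h) ((Γ.src_mul g h (hgs.trans hht.symm)).trans hhs)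
      ((Γ.tgt_mul g h (hgs.trans hht.symm)).trans hgt) = (act g hgs hgt).comp (act h hhs hht)
  smooth : ∀ (U : Set M), IsOpen U → ∀ Y : ∀ x, V x, Γ.SmoothOn (fun x => (Y x).1) U →
    ContMDiffOn 𝓘(ℝ, EG) 𝓘(ℝ, EG).tangent ∞
      (fun g => (⟨Γ.unit (Γ.tgt g), (act g rfl rfl (Y (Γ.src g))).1⟩ : TangentBundle 𝓘(ℝ, EG) G))
      (Γ.src ⁻¹' U)

/-- The representation `R` of the groupoid on `V` differentiates to the operator `D` (an
`A`-connection on `V`), i.e. integrates `D`: for smooth sections `X` of `A` and `Y` of `V`,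
`(D X Y)(x)` is the derivative at `τ = 0` of `γ(τ)⁻¹ · Y (tgt (γ τ))`, a curve in the vector
space `V x`, where `γ` is the integral curve through the unit over `x` of the right invariant
vector field of `X` (it stays in the source fibre over `x`; only its germ at `0` matters). -/
def Representation.Integrates {Γ : LieGroupoid EM EG M G}
    {V : ∀ x, Submodule ℝ (Γ.UnitTangent x)} (R : Γ.Representation V)
    (D : (∀ x, Γ.UnitTangent x) → (∀ x, Γ.UnitTangent x) → ∀ x, Γ.UnitTangent x) : Prop :=
  ∀ (X : ∀ x, Γ.UnitTangent x), Γ.SmoothOn X univ → (∀ x, X x ∈ Γ.algebroid x) →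
  ∀ (Y : ∀ x, V x), Γ.SmoothOn (fun x => (Y x).1) univ →
  ∀ (x : M) (γ : ℝ → G), γ 0 = Γ.unit x → ∀ hs : ∀ τ, Γ.src (γ τ) = x,
    IsMIntegralCurveAt γ (Γ.rightInvariant X) 0 →
    HasDerivAt (fun τ => (R.act (Γ.inv (γ τ)) (Γ.src_inv (γ τ))
      ((Γ.tgt_inv (γ τ)).trans (hs τ)) (Y (Γ.tgt (γ τ)))).1)
      (D X (fun x => (Y x).1) x) 0

end LieGroupoid

/-! ### Velocities of curves in manifolds. -/

section Velocity

variable {E : Type*} [NormedAddCommGroup E] [NormedSpace ℝ E] {H : Type*} [TopologicalSpace H]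
  {I : ModelWithCorners ℝ E H} {N : Type*} [TopologicalSpace N] [ChartedSpace H N]
  {E' : Type*} [NormedAddCommGroup E'] [NormedSpace ℝ E'] {H' : Type*} [TopologicalSpace H']
  {I' : ModelWithCorners ℝ E' H'} {N' : Type*} [TopologicalSpace N'] [ChartedSpace H' N']

/-! The representation is the adjoint action. A vector at $1_{s(g)}$ killed by both $ds$ and $dt$
can be left translated by $g$, being tangent to the target fibre, and the result can be right
translated by $g^{-1}$, being tangent to the source fibre. This is `Ad`; it is multiplicative
because the associative law can be differentiated (`Ad_mul`). Since the anchor vanishes on $I$, all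
of $I$ consists of such vectors. Two facts remain.

The derivative (`hasDerivAt_Ad_inv`). Put $Z(t)=\mathrm{Ad}_{\gamma(t)^{-1}}Y_{t(\gamma(t))}$. By
`dmul_right_eq_left`, $Y^R$ at $\gamma(t)$ is the left translate of $Z(t)$ by $\gamma(t)$, while
$X^R$ along a curve in the target fibre over $x$ is the right translate of the fixed vector $X_x$.
In a chart at the unit both are partial derivatives of one map $m$ extending the multiplication. In
the commutator the mixed second derivatives of $m$ cancel by symmetry, and $Z'(0)$ is left
(`fderiv_sub_fderiv_of_partial`). No flows are used, and the isotropy need not have constant rank.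

Invariance of $I$ (`IsIdeal.Ad_mem`). When a local frame of $I$ is transported to $x$ along the
source fibre, its derivative is the transport of brackets, which lie in $I$ again
(`IsIdeal.exists_hasDerivAt_Ad_inv`). So the spaces $\mathrm{Ad}_{h^{-1}}I_{t(h)}$, all inside
$T_{1_x}\mathcal G$, are the ranges of a family of linear maps, injective at the unit, whose
derivatives stay in the range; such a range is locally constant
(`eventually_range_eq_of_fderiv_mem_range`), hence equal to $I_x$ for $h$ near $1_x$. Right
translation moves this statement to every arrow, and connectedness of the source fibres makes it
global. -/

/-- The derivative of a map between manifolds, as a map between the model vector spaces. -/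
noncomputable def modelDeriv (I : ModelWithCorners ℝ E H) (I' : ModelWithCorners ℝ E' H')
    (f : N → N') (x : N) : E →L[ℝ] E' :=
  mfderiv I I' f x

/-- The curve `c` has velocity `v` at time `0`. -/
def HasVelocity (I : ModelWithCorners ℝ E H) (c : ℝ → N) (v : E) : Prop :=
  HasMFDerivAt 𝓘(ℝ, ℝ) I c 0 ((1 : ℝ →L[ℝ] ℝ).smulRight v : ℝ →L[ℝ] E)

theorem HasVelocity.continuousAt {c : ℝ → N} {v : E} (h : HasVelocity I c v) :
    ContinuousAt c 0 := HasMFDerivAt.continuousAt h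

theorem HasVelocity.unique {c : ℝ → N} {v w : E} (h : HasVelocity I c v)
    (h' : HasVelocity I c w) : v = w := by
  have := DFunLike.congr_fun (hasMFDerivAt_unique h h') (1 : ℝ)
  change (1 : ℝ) • v = (1 : ℝ) • w at this
  simpa using this

theorem HasVelocity.congr {c c' : ℝ → N} {v : E} (h : HasVelocity I c v) (hc : c' =ᶠ[𝓝 0] c) :
    HasVelocity I c' v := by
  exact HasMFDerivAt.congr_of_eventuallyEq h hc

theorem HasVelocity.comp_hasMFDerivWithinAt {c : ℝ → N} {v : E} (h : HasVelocity I c v)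
    {f : N → N'} {s : Set N} {x : N} (hx : c 0 = x) {f' : E →L[ℝ] E'}
    (hf : HasMFDerivWithinAt I I' f s x f') (hs : ∀ᶠ t in 𝓝 0, c t ∈ s) :
    HasVelocity I' (fun t => f (c t)) (f' v) := by
  subst hx
  have h1 : HasMFDerivWithinAt 𝓘(ℝ, ℝ) I c (c ⁻¹' s) 0
    ((1 : ℝ →L[ℝ] ℝ).smulRight v : ℝ →L[ℝ] E) := HasMFDerivAt.hasMFDerivWithinAt h
  have h2 := HasMFDerivWithinAt.comp (0 : ℝ) hf h1 subset_rfl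
  have h3 := HasMFDerivWithinAt.hasMFDerivAt h2 hs
  have e : ((1 : ℝ →L[ℝ] ℝ).smulRight (f' v) : ℝ →L[ℝ] E') =
      f'.comp ((1 : ℝ →L[ℝ] ℝ).smulRight v : ℝ →L[ℝ] E) := by ext; simp
  unfold HasVelocity
  rw [e]
  exact h3

theorem HasVelocity.comp {c : ℝ → N} {v : E} (h : HasVelocity I c v) {f : N → N'} {x : N}
    (hx : c 0 = x) (hf : MDifferentiableAt I I' f x) :
    HasVelocity I' (fun t => f (c t)) (modelDeriv I I' f x v) :=
  h.comp_hasMFDerivWithinAt hx (s := univ) hf.hasMFDerivAt.hasMFDerivWithinAt (by simp)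

theorem HasVelocity.prodMk {a : ℝ → N} {b : ℝ → N'} {u : E} {w : E'} (ha : HasVelocity I a u)
    (hb : HasVelocity I' b w) : HasVelocity (I.prod I') (fun t => (a t, b t)) (u, w) := by
  have := HasMFDerivAt.prodMk ha hb
  have e : ((1 : ℝ →L[ℝ] ℝ).smulRight (u, w) : ℝ →L[ℝ] E × E') =
      ((1 : ℝ →L[ℝ] ℝ).smulRight u : ℝ →L[ℝ] E).prod
        ((1 : ℝ →L[ℝ] ℝ).smulRight w : ℝ →L[ℝ] E') := by ext <;> simp
  unfold HasVelocity
  rw [e]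
  exact this

theorem HasVelocity.const (x : N) : HasVelocity I (fun _ => x) 0 := by
  have := hasMFDerivAt_const (I := 𝓘(ℝ, ℝ)) (I' := I) x (0 : ℝ)
  have e : ((1 : ℝ →L[ℝ] ℝ).smulRight 0 : ℝ →L[ℝ] E) = 0 := by ext; simp
  unfold HasVelocity
  rw [e]
  exact this

theorem hasVelocity_iff_hasDerivAt {c : ℝ → E} {v : E} :
    HasVelocity 𝓘(ℝ, E) c v ↔ HasDerivAt c v 0 := by
  unfold HasVelocity
  rw [hasDerivAt_iff_hasFDerivAt]
  exact hasMFDerivAt_iff_hasFDerivAt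

end Velocity

/-! ### Local sections of submersions and lifts of curves. -/

section Submersion

variable {E : Type*} [NormedAddCommGroup E] [NormedSpace ℝ E]
  {N : Type*} [TopologicalSpace N] [ChartedSpace E N]
  {E' : Type*} [NormedAddCommGroup E'] [NormedSpace ℝ E']
  {N' : Type*} [TopologicalSpace N'] [ChartedSpace E' N']

theorem exists_hasVelocity [IsManifold 𝓘(ℝ, E) ∞ N] (x : N) (v : E) : ∃ c : ℝ → N, c 0 = x ∧ HasVelocity 𝓘(ℝ, E) c v := by
  let φ := extChartAt 𝓘(ℝ, E) x
  have h0 : φ x + (0 : ℝ) • v = φ x := by simp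
  refine ⟨fun t => φ.symm (φ x + t • v), by simp [φ], ?_⟩
  have h1 : HasVelocity 𝓘(ℝ, E) (fun t : ℝ => φ x + t • v) v := by
    rw [hasVelocity_iff_hasDerivAt]
    simpa using ((hasDerivAt_id (0 : ℝ)).smul_const v).const_add (φ x)
  have h2 : MDifferentiableAt 𝓘(ℝ, E) 𝓘(ℝ, E) φ.symm (φ x) := by
    have := (contMDiffOn_extChartAt_symm (I := 𝓘(ℝ, E)) (n := 1) x).contMDiffAt
      (extChartAt_target_mem_nhds x)
    exact this.mdifferentiableAt one_ne_zero
  have h3 := h1.comp h0 h2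
  have h4 : modelDeriv 𝓘(ℝ, E) 𝓘(ℝ, E) φ.symm (φ x) = ContinuousLinearMap.id ℝ E := by
    have := mfderivWithin_range_extChartAt_symm (I := 𝓘(ℝ, E)) (x := x)
    rw [ModelWithCorners.Boundaryless.range_eq_univ, mfderivWithin_univ] at this
    exact this
  rwa [h4] at h3

/-- In adapted charts $f$ is a linear projection, and `σ (y, z)` replaces the base coordinate of `y`
by that of `z` and keeps the complementary one. It serves both as a smooth family of sections and as
a retraction onto each fibre. -/
theorem Manifold.IsSubmersionAt.exists_section {f : N → N'} {x : N}
    (hf : Manifold.IsSubmersionAt 𝓘(ℝ, E) 𝓘(ℝ, E') ∞ f x) :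
    ∃ σ : N × N' → N,
      (∀ᶠ p in 𝓝 (x, f x), ContMDiffAt (𝓘(ℝ, E).prod 𝓘(ℝ, E')) 𝓘(ℝ, E) ∞ σ p) ∧
      (∀ᶠ p in 𝓝 (x, f x), f (σ p) = p.2) ∧ ∀ᶠ y in 𝓝 x, σ (y, f y) = y := by
  obtain ⟨F, _, _, h⟩ := hf
  have hcont : ContinuousAt f x := h.contMDiffAt.continuousAt
  set φ := h.domChart
  set ψ := h.codChart
  set e := h.equiv
  have hx : x ∈ φ.source := h.mem_domChart_source
  have hfx : f x ∈ ψ.source := h.mem_codChart_source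
  have hφ := h.domChart_mem_maximalAtlas
  have hψ := h.codChart_mem_maximalAtlas
  have key : ∀ a ∈ φ.target, ψ (f (φ.symm a)) = (e a).1 := fun a ha => by
    have ha' : a ∈ (φ.extend 𝓘(ℝ, E)).target := by simpa using ha
    simpa using h.writtenInCharts ha'
  have hmaps : ∀ y ∈ φ.source, f y ∈ ψ.source := fun y hy => h.source_subset_preimage_source hy
  have key' : ∀ y ∈ φ.source, (e (φ y)).1 = ψ (f y) := fun y hy => by
    rw [← key _ (φ.map_source hy), φ.left_inv hy]
  let q : N × N' → E := fun p => e.symm (ψ p.2, (e (φ p.1)).2)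
  have hq0 : q (x, f x) = φ x := by
    simp only [q]; rw [← key' x hx]; simp
  have hq : ∀ p : N × N', p.1 ∈ φ.source → p.2 ∈ ψ.source →
      ContMDiffAt (𝓘(ℝ, E).prod 𝓘(ℝ, E')) 𝓘(ℝ, E) ∞ q p := by
    intro p hp1 hp2
    have h1 : ContMDiffAt (𝓘(ℝ, E).prod 𝓘(ℝ, E')) 𝓘(ℝ, E') ∞ (fun p : N × N' => ψ p.2) p :=
      ((contMDiffOn_of_mem_maximalAtlas hψ).contMDiffAt (ψ.open_source.mem_nhds hp2)).comp
        p contMDiffAt_snd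
    have h2 : ContMDiffAt (𝓘(ℝ, E).prod 𝓘(ℝ, E')) 𝓘(ℝ, E) ∞ (fun p : N × N' => φ p.1) p :=
      ((contMDiffOn_of_mem_maximalAtlas hφ).contMDiffAt (φ.open_source.mem_nhds hp1)).comp
        p contMDiffAt_fst
    have h3 : ContDiff ℝ ∞ (fun z : E' × E => e.symm (z.1, (e z.2).2)) := by fun_prop
    exact h3.contMDiff.contMDiffAt.comp p (h1.prodMk_space h2)
  have hsymm : ∀ a ∈ φ.target, ContMDiffAt 𝓘(ℝ, E) 𝓘(ℝ, E) ∞ φ.symm a := fun a ha =>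
    (contMDiffOn_symm_of_mem_maximalAtlas hφ).contMDiffAt (φ.open_target.mem_nhds ha)
  have hq1 : ∀ᶠ p in 𝓝 (x, f x), q p ∈ φ.target :=
    (hq (x, f x) hx hfx).continuousAt.eventually (by
      rw [hq0]; exact φ.open_target.mem_nhds (φ.map_source hx))
  have hq2 : ∀ᶠ p : N × N' in 𝓝 (x, f x), p.2 ∈ ψ.source :=
    continuousAt_snd.eventually (ψ.open_source.mem_nhds hfx)
  have hq3 : ∀ᶠ p : N × N' in 𝓝 (x, f x), p.1 ∈ φ.source :=
    continuousAt_fst.eventually (φ.open_source.mem_nhds hx)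
  refine ⟨fun p => φ.symm (q p), ?_, ?_, ?_⟩
  · filter_upwards [hq1, hq2, hq3] with p h1 h2 h3
    exact (hsymm _ h1).comp p (hq p h3 h2)
  · filter_upwards [hq1, hq2] with p hp hp'
    apply ψ.injOn (hmaps _ (φ.map_target hp)) hp'
    rw [key _ hp]
    simp [q]
  · filter_upwards [φ.open_source.mem_nhds hx] with y hy
    have : q (y, f y) = φ y := by
      simp only [q]; rw [← key' y hy]; simp
    rw [this, φ.left_inv hy]

/-- A curve in the base of a submersion lifts to a curve with prescribed velocity. -/
theorem Manifold.IsSubmersionAt.exists_lift [IsManifold 𝓘(ℝ, E) ∞ N] {f : N → N'} {x : N}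
    (hf : Manifold.IsSubmersionAt 𝓘(ℝ, E) 𝓘(ℝ, E') ∞ f x) {b : ℝ → N'} {v : E}
    (hb0 : b 0 = f x)
    (hb : HasVelocity 𝓘(ℝ, E') b (modelDeriv 𝓘(ℝ, E) 𝓘(ℝ, E') f x v)) :
    ∃ a : ℝ → N, a 0 = x ∧ HasVelocity 𝓘(ℝ, E) a v ∧ ∀ᶠ t in 𝓝 0, f (a t) = b t := by
  obtain ⟨σ, hσ, hfσ, hσf⟩ := hf.exists_section
  obtain ⟨c, hc0, hc⟩ := exists_hasVelocity x v
  have hfd : MDifferentiableAt 𝓘(ℝ, E) 𝓘(ℝ, E') f x :=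
    hf.contMDiffAt.mdifferentiableAt (by simp)
  have hσd := hσ.self_of_nhds.mdifferentiableAt (by simp)
  -- The lift is `σ (c t, b t)`. Since `b` and `f ∘ c` have the same velocity, it has the velocity
  -- of `σ (c t, f (c t))`, which is `c t` itself.
  have h1 := (hc.prodMk (hc.comp hc0 hfd)).comp (by simp [hc0]) hσd
  have h2 := (hc.prodMk hb).comp (by simp [hc0, hb0]) hσd
  have hcc : ContinuousAt c 0 := hc.continuousAt
  have hbc : ContinuousAt b 0 := hb.continuousAt
  have h3 : (fun t => σ (c t, f (c t))) =ᶠ[𝓝 0] c := by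
    have : ∀ᶠ y in 𝓝 (c 0), σ (y, f y) = y := by rwa [hc0]
    exact hcc.eventually this
  have h4 := (hc.congr h3).unique h1
  rw [← h4] at h2
  refine ⟨_, ?_, h2, ?_⟩
  · simpa [hc0, hb0] using hσf.self_of_nhds
  · have : ContinuousAt (fun t => (c t, b t)) 0 := hcc.prodMk hbc
    have h5 : ∀ᶠ p in 𝓝 (c 0, b 0), f (σ p) = p.2 := by rwa [hc0, hb0]
    exact this.eventually h5

end Submersion

/-! ### Groupoid identities and the differential of the multiplication. -/

namespace LieGroupoid

variable {EM : Type*} [NormedAddCommGroup EM] [NormedSpace ℝ EM]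
  {EG : Type*} [NormedAddCommGroup EG] [NormedSpace ℝ EG]
  {M : Type*} [TopologicalSpace M] [ChartedSpace EM M] [IsManifold 𝓘(ℝ, EM) ∞ M]
  {G : Type*} [TopologicalSpace G] [ChartedSpace EG G] [IsManifold 𝓘(ℝ, EG) ∞ G]

section Algebra

variable (Γ : LieGroupoid EM EG M G)

theorem eq_inv_of_mul_eq_unit {g h : G} (hgh : Γ.src g = Γ.tgt h)
    (h1 : Γ.mul g h = Γ.unit (Γ.tgt g)) : h = Γ.inv g := by
  have h2 : Γ.src (Γ.inv g) = Γ.tgt g := Γ.src_inv g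
  calc h = Γ.mul (Γ.mul (Γ.inv g) g) h := by rw [Γ.inv_mul, hgh, Γ.unit_mul]
    _ = Γ.mul (Γ.inv g) (Γ.unit (Γ.tgt g)) := by rw [Γ.mul_assoc _ _ _ h2 hgh, h1]
    _ = Γ.inv g := by rw [← h2, Γ.mul_unit]

theorem inv_unit (x : M) : Γ.inv (Γ.unit x) = Γ.unit x := by
  refine (Γ.eq_inv_of_mul_eq_unit ?_ ?_).symm
  · rw [Γ.src_unit, Γ.tgt_unit]
  · have := Γ.unit_mul (Γ.unit x)
    rw [Γ.tgt_unit] at this ⊢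
    exact this

theorem inv_mul_rev {g h : G} (hgh : Γ.src g = Γ.tgt h) :
    Γ.inv (Γ.mul g h) = Γ.mul (Γ.inv h) (Γ.inv g) := by
  have h2 : Γ.src h = Γ.tgt (Γ.inv h) := (Γ.tgt_inv h).symm
  have h3 : Γ.src (Γ.inv h) = Γ.tgt (Γ.inv g) := by rw [Γ.src_inv, Γ.tgt_inv, hgh]
  have h4 : Γ.src h = Γ.tgt (Γ.mul (Γ.inv h) (Γ.inv g)) := by rw [Γ.tgt_mul _ _ h3, h2]
  refine (Γ.eq_inv_of_mul_eq_unit ?_ ?_).symm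
  · rw [Γ.src_mul _ _ hgh, h4]
  · rw [Γ.mul_assoc _ _ _ hgh h4, ← Γ.mul_assoc h _ _ h2 h3, Γ.mul_inv, ← hgh, ← Γ.tgt_inv g,
      Γ.unit_mul, Γ.mul_inv, Γ.tgt_mul _ _ hgh]

theorem mul_inv_cancel_right {g h : G} (hgh : Γ.src g = Γ.tgt h) :
    Γ.mul (Γ.mul g h) (Γ.inv h) = g := by
  rw [Γ.mul_assoc _ _ _ hgh (Γ.tgt_inv h).symm, Γ.mul_inv, ← hgh, Γ.mul_unit]

theorem inv_mul_cancel_right {g h : G} (hgh : Γ.src g = Γ.src h) :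
    Γ.mul (Γ.mul g (Γ.inv h)) h = g := by
  rw [Γ.mul_assoc _ _ _ (by rw [hgh, Γ.tgt_inv]) (Γ.src_inv h), Γ.inv_mul, ← hgh, Γ.mul_unit]

end Algebra

section Tangent

variable (Γ : LieGroupoid EM EG M G)

theorem contMDiff_src : ContMDiff 𝓘(ℝ, EG) 𝓘(ℝ, EM) ∞ Γ.src := fun g =>
  (Γ.src_submersion.isSubmersionAt g).contMDiffAt

theorem contMDiff_tgt : ContMDiff 𝓘(ℝ, EG) 𝓘(ℝ, EM) ∞ Γ.tgt := fun g =>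
  (Γ.tgt_submersion.isSubmersionAt g).contMDiffAt

/-- The set of composable pairs. -/
def composable : Set (G × G) := {p | Γ.src p.1 = Γ.tgt p.2}

/-- The derivative of the source map. -/
noncomputable def dsrc (g : G) : EG →L[ℝ] EM := modelDeriv 𝓘(ℝ, EG) 𝓘(ℝ, EM) Γ.src g

/-- The derivative of the target map. -/
noncomputable def dtgt (g : G) : EG →L[ℝ] EM := modelDeriv 𝓘(ℝ, EG) 𝓘(ℝ, EM) Γ.tgt g

/-- The derivative of the multiplication; it is meaningful only on vectors tangent to the set of
composable pairs. -/
noncomputable def dmul (g h : G) : EG × EG →L[ℝ] EG :=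
  mfderivWithin (𝓘(ℝ, EG).prod 𝓘(ℝ, EG)) 𝓘(ℝ, EG) (fun p : G × G => Γ.mul p.1 p.2)
    Γ.composable (g, h)

variable {Γ}

theorem hasVelocity_src {c : ℝ → G} {v : EG} (hc : HasVelocity 𝓘(ℝ, EG) c v) :
    HasVelocity 𝓘(ℝ, EM) (fun t => Γ.src (c t)) (Γ.dsrc (c 0) v) :=
  hc.comp rfl (Γ.contMDiff_src.mdifferentiable (by simp) _)

theorem hasVelocity_tgt {c : ℝ → G} {v : EG} (hc : HasVelocity 𝓘(ℝ, EG) c v) :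
    HasVelocity 𝓘(ℝ, EM) (fun t => Γ.tgt (c t)) (Γ.dtgt (c 0) v) :=
  hc.comp rfl (Γ.contMDiff_tgt.mdifferentiable (by simp) _)

theorem hasVelocity_mul {a b : ℝ → G} {u w : EG} (ha : HasVelocity 𝓘(ℝ, EG) a u)
    (hb : HasVelocity 𝓘(ℝ, EG) b w) (hab : ∀ᶠ t in 𝓝 0, Γ.src (a t) = Γ.tgt (b t)) :
    HasVelocity 𝓘(ℝ, EG) (fun t => Γ.mul (a t) (b t)) (Γ.dmul (a 0) (b 0) (u, w)) := by
  have h0 : (a 0, b 0) ∈ Γ.composable := hab.self_of_nhds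
  have h1 : HasMFDerivWithinAt (𝓘(ℝ, EG).prod 𝓘(ℝ, EG)) 𝓘(ℝ, EG)
      (fun p : G × G => Γ.mul p.1 p.2) Γ.composable (a 0, b 0) (Γ.dmul (a 0) (b 0)) :=
    ((Γ.smooth_mul _ h0).mdifferentiableWithinAt (by simp)).hasMFDerivWithinAt
  exact (ha.prodMk hb).comp_hasMFDerivWithinAt rfl h1 hab

theorem exists_lift_src {g : G} {u : EG} {b : ℝ → M} {w : EM} (hb0 : b 0 = Γ.src g)
    (hb : HasVelocity 𝓘(ℝ, EM) b w) (hu : Γ.dsrc g u = w) :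
    ∃ a : ℝ → G, a 0 = g ∧ HasVelocity 𝓘(ℝ, EG) a u ∧ ∀ᶠ t in 𝓝 0, Γ.src (a t) = b t := by
  subst hu
  exact (Γ.src_submersion.isSubmersionAt g).exists_lift hb0 hb

theorem exists_lift_tgt {g : G} {u : EG} {b : ℝ → M} {w : EM} (hb0 : b 0 = Γ.tgt g)
    (hb : HasVelocity 𝓘(ℝ, EM) b w) (hu : Γ.dtgt g u = w) :
    ∃ a : ℝ → G, a 0 = g ∧ HasVelocity 𝓘(ℝ, EG) a u ∧ ∀ᶠ t in 𝓝 0, Γ.tgt (a t) = b t := by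
  subst hu
  exact (Γ.tgt_submersion.isSubmersionAt g).exists_lift hb0 hb

/-- As the source is a submersion, every infinitesimally composable pair comes from a composable
curve. Identities for `dmul` then follow by differentiating groupoid identities along such curves.
-/
theorem exists_composable_curve {g : G} {u w : EG} {b : ℝ → G} (hb0 : Γ.src g = Γ.tgt (b 0))
    (hb : HasVelocity 𝓘(ℝ, EG) b w) (hu : Γ.dsrc g u = Γ.dtgt (b 0) w) :
    ∃ a : ℝ → G, a 0 = g ∧ HasVelocity 𝓘(ℝ, EG) a u ∧
      ∀ᶠ t in 𝓝 0, Γ.src (a t) = Γ.tgt (b t) :=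
  exists_lift_src hb0.symm (hasVelocity_tgt hb) hu

theorem dsrc_dmul {g h : G} {u w : EG} (hgh : Γ.src g = Γ.tgt h)
    (huw : Γ.dsrc g u = Γ.dtgt h w) :
    Γ.dsrc (Γ.mul g h) (Γ.dmul g h (u, w)) = Γ.dsrc h w := by
  obtain ⟨b, rfl, hb⟩ := exists_hasVelocity h w
  obtain ⟨a, rfl, ha, hab⟩ := exists_composable_curve hgh hb huw
  refine (hasVelocity_src (hasVelocity_mul ha hb hab)).unique ((hasVelocity_src hb).congr ?_)
  filter_upwards [hab] with t ht using Γ.src_mul _ _ ht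

theorem dtgt_dmul {g h : G} {u w : EG} (hgh : Γ.src g = Γ.tgt h)
    (huw : Γ.dsrc g u = Γ.dtgt h w) :
    Γ.dtgt (Γ.mul g h) (Γ.dmul g h (u, w)) = Γ.dtgt g u := by
  obtain ⟨b, rfl, hb⟩ := exists_hasVelocity h w
  obtain ⟨a, rfl, ha, hab⟩ := exists_composable_curve hgh hb huw
  refine (hasVelocity_tgt (hasVelocity_mul ha hb hab)).unique ((hasVelocity_tgt ha).congr ?_)
  filter_upwards [hab] with t ht using Γ.tgt_mul _ _ ht

theorem dmul_assoc {g h k : G} {u v w : EG} (hgh : Γ.src g = Γ.tgt h) (hhk : Γ.src h = Γ.tgt k)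
    (huv : Γ.dsrc g u = Γ.dtgt h v) (hvw : Γ.dsrc h v = Γ.dtgt k w) :
    Γ.dmul (Γ.mul g h) k (Γ.dmul g h (u, v), w) =
      Γ.dmul g (Γ.mul h k) (u, Γ.dmul h k (v, w)) := by
  obtain ⟨c, rfl, hc⟩ := exists_hasVelocity k w
  obtain ⟨b, rfl, hb, hbc⟩ := exists_composable_curve hhk hc hvw
  obtain ⟨a, rfl, ha, hab⟩ := exists_composable_curve hgh hb huv
  have h1 : ∀ᶠ t in 𝓝 0, Γ.src (Γ.mul (a t) (b t)) = Γ.tgt (c t) := by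
    filter_upwards [hab, hbc] with t h1 h2 using (Γ.src_mul _ _ h1).trans h2
  have h2 : ∀ᶠ t in 𝓝 0, Γ.src (a t) = Γ.tgt (Γ.mul (b t) (c t)) := by
    filter_upwards [hab, hbc] with t h1 h2 using h1.trans (Γ.tgt_mul _ _ h2).symm
  refine (hasVelocity_mul (hasVelocity_mul ha hb hab) hc h1).unique
    ((hasVelocity_mul ha (hasVelocity_mul hb hc hbc) h2).congr ?_)
  filter_upwards [hab, hbc] with t h1 h2 using Γ.mul_assoc _ _ _ h1 h2

/-- The curve representing `w` can be kept in the target fibre, so that one fixed unit acts on all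
of it. -/
theorem dmul_unit_left {g : G} {w : EG} (hw : Γ.dtgt g w = 0) :
    Γ.dmul (Γ.unit (Γ.tgt g)) g (0, w) = w := by
  obtain ⟨b, rfl, hb, hbt⟩ := exists_lift_tgt (b := fun _ => Γ.tgt g) rfl (.const _) hw
  have h1 : ∀ᶠ t in 𝓝 0, Γ.src (Γ.unit (Γ.tgt (b 0))) = Γ.tgt (b t) := by
    filter_upwards [hbt] with t ht using by rw [ht, Γ.src_unit]
  refine (hasVelocity_mul (HasVelocity.const _) hb h1).unique (hb.congr ?_)
  filter_upwards [hbt] with t ht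
  rw [← ht, Γ.unit_mul]

theorem dmul_unit_right {g : G} {u : EG} (hu : Γ.dsrc g u = 0) :
    Γ.dmul g (Γ.unit (Γ.src g)) (u, 0) = u := by
  obtain ⟨a, rfl, ha, has⟩ := exists_lift_src (b := fun _ => Γ.src g) rfl (.const _) hu
  have h1 : ∀ᶠ t in 𝓝 0, Γ.src (a t) = Γ.tgt (Γ.unit (Γ.src (a 0))) := by
    filter_upwards [has] with t ht using by rw [ht, Γ.tgt_unit]
  refine (hasVelocity_mul ha (HasVelocity.const _) h1).unique (ha.congr ?_)
  filter_upwards [has] with t ht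
  rw [← ht, Γ.mul_unit]

/-- The right invariant vector field is right translation by the derivative of the
multiplication. -/
theorem rightInvariant_eq {X : ∀ x, Γ.UnitTangent x} {g : G}
    (hX : X (Γ.tgt g) ∈ Γ.algebroid (Γ.tgt g)) :
    Γ.rightInvariant X g = Γ.dmul (Γ.unit (Γ.tgt g)) g ((X (Γ.tgt g) : EG), 0) := by
  set e := Γ.unit (Γ.tgt g) with he
  have hse : Γ.src e = Γ.tgt g := Γ.src_unit _
  have hX' : Γ.dsrc e (X (Γ.tgt g)) = 0 := hX
  obtain ⟨a, ha0, ha, has⟩ := exists_lift_src (b := fun _ => Γ.tgt g) hse.symm (.const _) hX'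
  have h1 : HasVelocity 𝓘(ℝ, EG) (fun t => Γ.mul (a t) g) (Γ.dmul (a 0) g ((X (Γ.tgt g) : EG), 0)) :=
    hasVelocity_mul ha (HasVelocity.const g) has
  rw [ha0] at h1
  have h2 : MDifferentiableWithinAt 𝓘(ℝ, EG) 𝓘(ℝ, EG) (fun h => Γ.mul h g)
      (Γ.src ⁻¹' {Γ.tgt g}) e := by
    have h3 : MDifferentiableWithinAt (𝓘(ℝ, EG).prod 𝓘(ℝ, EG)) 𝓘(ℝ, EG)
      (fun p : G × G => Γ.mul p.1 p.2) Γ.composable (e, g) :=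
      (Γ.smooth_mul (e, g) hse).mdifferentiableWithinAt (by simp)
    have h4 : MDifferentiableAt 𝓘(ℝ, EG) (𝓘(ℝ, EG).prod 𝓘(ℝ, EG)) (fun h : G => (h, g)) e :=
      mdifferentiableAt_id.prodMk mdifferentiableAt_const
    exact h3.comp e h4.mdifferentiableWithinAt (fun h hh => hh)
  have h5 := ha.comp_hasMFDerivWithinAt ha0 h2.hasMFDerivWithinAt has
  exact h5.unique h1

end Tangent

/-! ### The adjoint action on isotropy vectors. -/

section Adjoint

variable (Γ : LieGroupoid EM EG M G)

/-- The tangent vectors at a unit that are tangent to both the source and the target fibre. -/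
noncomputable def isotropy (x : M) : Submodule ℝ EG :=
  LinearMap.ker (Γ.dsrc (Γ.unit x)).toLinearMap ⊓ LinearMap.ker (Γ.dtgt (Γ.unit x)).toLinearMap

/-- The adjoint action of an arrow `g`, meaningful on the isotropy at the source of `g`. -/
noncomputable def Ad (g : G) : EG →L[ℝ] EG :=
  ((Γ.dmul g (Γ.inv g)).comp (ContinuousLinearMap.inl ℝ EG EG)).comp
    ((Γ.dmul g (Γ.unit (Γ.src g))).comp (ContinuousLinearMap.inr ℝ EG EG))

variable {Γ}

theorem mem_isotropy {x : M} {v : EG} :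
    v ∈ Γ.isotropy x ↔ Γ.dsrc (Γ.unit x) v = 0 ∧ Γ.dtgt (Γ.unit x) v = 0 := Iff.rfl

theorem Ad_apply (g : G) (v : EG) :
    Γ.Ad g v = Γ.dmul g (Γ.inv g) (Γ.dmul g (Γ.unit (Γ.src g)) (0, v), 0) := rfl

/-- Left translation of an isotropy vector. -/
theorem dsrc_dmul_unit {g : G} {v : EG} (hv : v ∈ Γ.isotropy (Γ.src g)) :
    Γ.dsrc g (Γ.dmul g (Γ.unit (Γ.src g)) (0, v)) = 0 := by
  have := dsrc_dmul (Γ := Γ) (g := g) (h := Γ.unit (Γ.src g)) (u := 0) (w := v)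
    (Γ.tgt_unit _).symm (by rw [map_zero, (mem_isotropy.1 hv).2])
  rwa [Γ.mul_unit, (mem_isotropy.1 hv).1] at this

theorem dtgt_dmul_unit {g : G} {v : EG} (hv : v ∈ Γ.isotropy (Γ.src g)) :
    Γ.dtgt g (Γ.dmul g (Γ.unit (Γ.src g)) (0, v)) = 0 := by
  have := dtgt_dmul (Γ := Γ) (g := g) (h := Γ.unit (Γ.src g)) (u := 0) (w := v)
    (Γ.tgt_unit _).symm (by rw [map_zero, (mem_isotropy.1 hv).2])
  rwa [Γ.mul_unit, map_zero] at this

theorem Ad_mem {g : G} {v : EG} (hv : v ∈ Γ.isotropy (Γ.src g)) :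
    Γ.Ad g v ∈ Γ.isotropy (Γ.tgt g) := by
  have h1 := dsrc_dmul_unit hv
  have h2 := dtgt_dmul_unit hv
  have hc : Γ.src g = Γ.tgt (Γ.inv g) := (Γ.tgt_inv g).symm
  have h3 := dsrc_dmul (Γ := Γ) hc (u := Γ.dmul g (Γ.unit (Γ.src g)) (0, v)) (w := 0)
    (by rw [h1, map_zero])
  have h4 := dtgt_dmul (Γ := Γ) hc (u := Γ.dmul g (Γ.unit (Γ.src g)) (0, v)) (w := 0)
    (by rw [h1, map_zero])
  rw [Γ.mul_inv, map_zero] at h3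
  rw [Γ.mul_inv, h2] at h4
  exact ⟨h3, h4⟩

theorem Ad_unit {x : M} {v : EG} (hv : v ∈ Γ.isotropy x) : Γ.Ad (Γ.unit x) v = v := by
  have h1 := dmul_unit_left (mem_isotropy.1 hv).2
  have h2 := dmul_unit_right (mem_isotropy.1 hv).1
  rw [Γ.tgt_unit] at h1
  rw [Γ.src_unit] at h2
  rw [Ad_apply, Γ.inv_unit, Γ.src_unit, h1, h2]

/-- Three uses of differentiated associativity: one splits left translation by $gh$, one splits
right translation by $h^{-1}g^{-1}$, and one moves left translation by $g$ past right translation by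
$h^{-1}$. -/
theorem Ad_mul {g h : G} (hgh : Γ.src g = Γ.tgt h) {v : EG} (hv : v ∈ Γ.isotropy (Γ.src h)) :
    Γ.Ad (Γ.mul g h) v = Γ.Ad g (Γ.Ad h v) := by
  have hc : Γ.src h = Γ.tgt (Γ.inv h) := (Γ.tgt_inv h).symm
  have hc' : Γ.src (Γ.inv h) = Γ.tgt (Γ.inv g) := by rw [Γ.src_inv, Γ.tgt_inv, hgh]
  have hgi : Γ.src g = Γ.tgt (Γ.inv g) := (Γ.tgt_inv g).symm
  have hs : Γ.src (Γ.mul g h) = Γ.src h := Γ.src_mul _ _ hgh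
  have z : ∀ a b : G, Γ.dmul a b (0, 0) = 0 := fun a b => (Γ.dmul a b).map_zero
  set v₁ := Γ.dmul h (Γ.unit (Γ.src h)) (0, v) with hv₁
  have h1 : Γ.dmul (Γ.mul g h) (Γ.unit (Γ.src h)) (0, v) = Γ.dmul g h (0, v₁) := by
    have := dmul_assoc (Γ := Γ) (k := Γ.unit (Γ.src h)) (u := 0) (v := 0) (w := v) hgh
      (Γ.tgt_unit _).symm (by simp) (by rw [map_zero, (mem_isotropy.1 hv).2])
    rwa [z, Γ.mul_unit] at this
  have hsv : Γ.dsrc h v₁ = 0 := dsrc_dmul_unit hv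
  have htv : Γ.dtgt h v₁ = 0 := dtgt_dmul_unit hv
  have hsv' : Γ.dsrc (Γ.mul g h) (Γ.dmul g h (0, v₁)) = 0 := by
    rw [dsrc_dmul hgh (by rw [map_zero, htv]), hsv]
  have h2 := dmul_assoc (Γ := Γ) (g := Γ.mul g h) (h := Γ.inv h) (k := Γ.inv g)
    (u := Γ.dmul g h (0, v₁)) (v := 0) (w := 0) (hs.trans hc) hc' (by rw [hsv', map_zero])
    (by simp)
  have h3 := dmul_assoc (Γ := Γ) (g := g) (h := h) (k := Γ.inv h) (u := 0) (v := v₁) (w := 0)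
    hgh hc (by rw [map_zero, htv]) (by rw [hsv, map_zero])
  rw [Γ.mul_inv] at h3
  rw [Ad_apply, hs, h1, Γ.inv_mul_rev hgh, Ad_apply g, Ad_apply h, ← hv₁, hgh, ← h3]
  rw [z, Γ.mul_inv_cancel_right hgh] at h2
  exact h2.symm

theorem Ad_inv_Ad {g : G} {v : EG} (hv : v ∈ Γ.isotropy (Γ.src g)) :
    Γ.Ad (Γ.inv g) (Γ.Ad g v) = v := by
  rw [← Ad_mul (Γ.src_inv g) hv, Γ.inv_mul, Ad_unit hv]

theorem Ad_Ad_inv {g : G} {v : EG} (hv : v ∈ Γ.isotropy (Γ.tgt g)) :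
    Γ.Ad g (Γ.Ad (Γ.inv g) v) = v := by
  rw [← Ad_mul (Γ.tgt_inv g).symm (by rwa [Γ.src_inv]), Γ.mul_inv, Ad_unit hv]

/-- Right translation of an isotropy vector is left translation of its conjugate. -/
theorem dmul_right_eq_left {g : G} {v : EG} (hv : v ∈ Γ.isotropy (Γ.tgt g)) :
    Γ.dmul (Γ.unit (Γ.tgt g)) g (v, 0) =
      Γ.dmul g (Γ.unit (Γ.src g)) (0, Γ.Ad (Γ.inv g) v) := by
  have hv' : Γ.Ad (Γ.inv g) v ∈ Γ.isotropy (Γ.src g) := by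
    have := Ad_mem (Γ := Γ) (g := Γ.inv g) (v := v) (by rwa [Γ.src_inv])
    rwa [Γ.tgt_inv] at this
  have h1 := dsrc_dmul_unit hv'
  -- Right translate by $g^{-1}$ and then by $g$: the first turns the left translate into `Ad g (Ad
  -- (inv g) v)`, which is `v`, and the two together do nothing.
  have h := dmul_assoc (Γ := Γ) (g := g) (h := Γ.inv g) (k := g)
    (u := Γ.dmul g (Γ.unit (Γ.src g)) (0, Γ.Ad (Γ.inv g) v)) (v := 0) (w := 0)
    (Γ.tgt_inv g).symm (Γ.src_inv g) (by rw [h1, map_zero]) (by simp)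
  rw [← Ad_apply, Ad_Ad_inv hv, Γ.mul_inv, Γ.inv_mul,
    show Γ.dmul (Γ.inv g) g (0, 0) = 0 from (Γ.dmul _ _).map_zero, dmul_unit_right h1] at h
  exact h

end Adjoint

end LieGroupoid

/-! ### Smooth dependence of differentials on parameters. -/

section Push

variable {F : Type*} [NormedAddCommGroup F] [NormedSpace ℝ F] {N : Type*} [TopologicalSpace N]
  [ChartedSpace F N]
  {E : Type*} [NormedAddCommGroup E] [NormedSpace ℝ E] {K : Type*} [TopologicalSpace K]
  [ChartedSpace E K] [IsManifold 𝓘(ℝ, E) ∞ K]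
  {E' : Type*} [NormedAddCommGroup E'] [NormedSpace ℝ E'] {K' : Type*} [TopologicalSpace K']
  [ChartedSpace E' K']

/-- The partial derivative of a smooth family of maps, applied to a smooth vector field along a
map, is smooth. -/
theorem contMDiffAt_modelDeriv_apply [IsManifold 𝓘(ℝ, F) ∞ N] [IsManifold 𝓘(ℝ, E') ∞ K']
    {ν : N → K → K'} {b : N → K}
    {X : N → E} {n : N}
    (hν : ContMDiffAt (𝓘(ℝ, F).prod 𝓘(ℝ, E)) 𝓘(ℝ, E') ∞ (Function.uncurry ν) (n, b n))
    (hX : ContMDiffAt 𝓘(ℝ, F) 𝓘(ℝ, E).tangent ∞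
      (fun m => (⟨b m, X m⟩ : TangentBundle 𝓘(ℝ, E) K)) n) :
    ContMDiffAt 𝓘(ℝ, F) 𝓘(ℝ, E').tangent ∞
      (fun m => (⟨ν m (b m), modelDeriv 𝓘(ℝ, E) 𝓘(ℝ, E') (ν m) (b m) (X m)⟩ :
        TangentBundle 𝓘(ℝ, E') K')) n := by
  have hb : ContMDiffAt 𝓘(ℝ, F) 𝓘(ℝ, E) ∞ b n := by
    rw [Bundle.contMDiffAt_totalSpace] at hX
    exact hX.1
  have hφ := ContMDiffAt.mfderiv ν b hν hb (m := ∞) (by simp)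
  have hb₂ : ContMDiffAt 𝓘(ℝ, F) 𝓘(ℝ, E') ∞ (fun m => ν m (b m)) n :=
    hν.comp n (contMDiffAt_id.prodMk hb)
  exact ContMDiffAt.clm_apply_of_inCoordinates (b₁ := b) (b₂ := fun m => ν m (b m))
    (v := fun m => (X m : TangentSpace 𝓘(ℝ, E) (b m)))
    (ϕ := fun m => mfderiv 𝓘(ℝ, E) 𝓘(ℝ, E') (ν m) (b m)) hφ hX hb₂

theorem modelDeriv_partial_left {μ : K × K' → K} {x : K} {y : K'}
    (hμ : MDifferentiableAt (𝓘(ℝ, E).prod 𝓘(ℝ, E')) 𝓘(ℝ, E) μ (x, y)) (v : E) :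
    modelDeriv 𝓘(ℝ, E) 𝓘(ℝ, E) (fun k => μ (k, y)) x v =
      modelDeriv (𝓘(ℝ, E).prod 𝓘(ℝ, E')) 𝓘(ℝ, E) μ (x, y) (v, 0) := by
  obtain ⟨c, rfl, hc⟩ := exists_hasVelocity x v
  have h1 : MDifferentiableAt 𝓘(ℝ, E) 𝓘(ℝ, E) (fun k => μ (k, y)) (c 0) :=
    hμ.comp (c 0) (mdifferentiableAt_id.prodMk mdifferentiableAt_const)
  exact (hc.comp rfl h1).unique ((hc.prodMk (HasVelocity.const y)).comp rfl hμ)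

theorem modelDeriv_partial_right {μ : K' × K → K} {x : K} {y : K'}
    (hμ : MDifferentiableAt (𝓘(ℝ, E').prod 𝓘(ℝ, E)) 𝓘(ℝ, E) μ (y, x)) (v : E) :
    modelDeriv 𝓘(ℝ, E) 𝓘(ℝ, E) (fun k => μ (y, k)) x v =
      modelDeriv (𝓘(ℝ, E').prod 𝓘(ℝ, E)) 𝓘(ℝ, E) μ (y, x) (0, v) := by
  obtain ⟨c, rfl, hc⟩ := exists_hasVelocity x v
  have h1 : MDifferentiableAt 𝓘(ℝ, E) 𝓘(ℝ, E) (fun k => μ (y, k)) (c 0) :=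
    hμ.comp (c 0) (mdifferentiableAt_const.prodMk mdifferentiableAt_id)
  exact (hc.comp rfl h1).unique (((HasVelocity.const y).prodMk hc).comp rfl hμ)

end Push

/-! ### Smoothness of translated vector fields and of the adjoint action. -/

namespace LieGroupoid

variable {EM : Type*} [NormedAddCommGroup EM] [NormedSpace ℝ EM]
  {EG : Type*} [NormedAddCommGroup EG] [NormedSpace ℝ EG]
  {M : Type*} [TopologicalSpace M] [ChartedSpace EM M] [IsManifold 𝓘(ℝ, EM) ∞ M]
  {G : Type*} [TopologicalSpace G] [ChartedSpace EG G] [IsManifold 𝓘(ℝ, EG) ∞ G]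
  {Γ : LieGroupoid EM EG M G}

/-- Near a composable pair, the multiplication extends to a smooth map on all pairs. -/
theorem exists_mul_extension {g h : G} (hgh : Γ.src g = Γ.tgt h) :
    ∃ μ : G × G → G, ContMDiffAt (𝓘(ℝ, EG).prod 𝓘(ℝ, EG)) 𝓘(ℝ, EG) ∞ μ (g, h) ∧
      ∀ᶠ p in 𝓝 (g, h), Γ.src p.1 = Γ.tgt p.2 → μ p = Γ.mul p.1 p.2 := by
  obtain ⟨σ, hσ, hsσ, hσs⟩ := (Γ.src_submersion.isSubmersionAt g).exists_section
  have hσg : σ (g, Γ.tgt h) = g := by rw [← hgh]; exact hσs.self_of_nhds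
  -- A local retraction onto the composable pairs: the first factor is moved to the source fibre
  -- over the target of the second.
  let r : G × G → G × G := fun p => (σ (p.1, Γ.tgt p.2), p.2)
  have hr0 : r (g, h) = (g, h) := by simp [r, hσg]
  have ht : ContMDiffAt (𝓘(ℝ, EG).prod 𝓘(ℝ, EG)) (𝓘(ℝ, EG).prod 𝓘(ℝ, EM)) ∞
      (fun p : G × G => (p.1, Γ.tgt p.2)) (g, h) :=
    contMDiffAt_fst.prodMk ((Γ.contMDiff_tgt _).comp (g, h) contMDiffAt_snd)
  have hr : ContMDiffAt (𝓘(ℝ, EG).prod 𝓘(ℝ, EG)) (𝓘(ℝ, EG).prod 𝓘(ℝ, EG)) ∞ r (g, h) :=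
    (ContMDiffAt.comp (g, h) (by rw [← hgh]; exact hσ.self_of_nhds) ht).prodMk contMDiffAt_snd
  have hrC : ∀ᶠ p in 𝓝 (g, h), r p ∈ Γ.composable := by
    rw [hgh] at hsσ
    exact ht.continuousAt.eventually hsσ
  refine ⟨fun p => Γ.mul (r p).1 (r p).2, ?_, ?_⟩
  · have h1 : ContMDiffWithinAt (𝓘(ℝ, EG).prod 𝓘(ℝ, EG)) 𝓘(ℝ, EG) ∞
        (fun p : G × G => Γ.mul p.1 p.2) Γ.composable (r (g, h)) := by
      rw [hr0]; exact Γ.smooth_mul _ hgh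
    exact (h1.comp (g, h) (hr.contMDiffWithinAt (s := r ⁻¹' Γ.composable))
      (mapsTo_preimage _ _)).contMDiffAt hrC
  · filter_upwards [continuousAt_fst.eventually hσs] with p hp hc
    simp only [r]
    rw [← hc, hp]

/-- On vectors tangent to the composable pairs the derivative can be read off composable curves,
along which `μ` is the multiplication. This trades a derivative within a subset for an honest one,
whose smoothness is accessible. -/
theorem dmul_eq_modelDeriv {g h : G} {μ : G × G → G}
    (hμ : MDifferentiableAt (𝓘(ℝ, EG).prod 𝓘(ℝ, EG)) 𝓘(ℝ, EG) μ (g, h))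
    (hμm : ∀ᶠ p in 𝓝 (g, h), Γ.src p.1 = Γ.tgt p.2 → μ p = Γ.mul p.1 p.2)
    (hgh : Γ.src g = Γ.tgt h) {u w : EG} (huw : Γ.dsrc g u = Γ.dtgt h w) :
    Γ.dmul g h (u, w) = modelDeriv (𝓘(ℝ, EG).prod 𝓘(ℝ, EG)) 𝓘(ℝ, EG) μ (g, h) (u, w) := by
  obtain ⟨b, rfl, hb⟩ := exists_hasVelocity h w
  obtain ⟨a, rfl, ha, hab⟩ := exists_composable_curve hgh hb huw
  refine (hasVelocity_mul ha hb hab).unique (((ha.prodMk hb).comp rfl hμ).congr ?_)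
  have hc : ContinuousAt (fun t => (a t, b t)) 0 := ha.continuousAt.prodMk hb.continuousAt
  filter_upwards [hab, hc.eventually hμm] with t h1 h2 using (h2 h1).symm

section Smooth

variable {F : Type*} [NormedAddCommGroup F] [NormedSpace ℝ F] {N : Type*} [TopologicalSpace N]
  [ChartedSpace F N] [IsManifold 𝓘(ℝ, F) ∞ N]

/-- The condition on `dsrc` makes `(X, 0)` tangent to the composable pairs, so `dmul` is there a
partial derivative of a smooth extension of the multiplication. -/
theorem contMDiffAt_dmul_left {p q : N → G} {X : N → EG} {n : N}
    (hX : ContMDiffAt 𝓘(ℝ, F) 𝓘(ℝ, EG).tangent ∞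
      (fun m => (⟨p m, X m⟩ : TangentBundle 𝓘(ℝ, EG) G)) n)
    (hq : ContMDiffAt 𝓘(ℝ, F) 𝓘(ℝ, EG) ∞ q n)
    (hpq : ∀ᶠ m in 𝓝 n, Γ.src (p m) = Γ.tgt (q m))
    (hsX : ∀ᶠ m in 𝓝 n, Γ.dsrc (p m) (X m) = 0) :
    ContMDiffAt 𝓘(ℝ, F) 𝓘(ℝ, EG).tangent ∞
      (fun m => (⟨Γ.mul (p m) (q m), Γ.dmul (p m) (q m) (X m, 0)⟩ :
        TangentBundle 𝓘(ℝ, EG) G)) n := by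
  obtain ⟨μ, hμ, hμm⟩ := exists_mul_extension hpq.self_of_nhds
  have hp : ContMDiffAt 𝓘(ℝ, F) 𝓘(ℝ, EG) ∞ p n := by
    rw [Bundle.contMDiffAt_totalSpace] at hX
    exact hX.1
  have hν : ContMDiffAt (𝓘(ℝ, F).prod 𝓘(ℝ, EG)) 𝓘(ℝ, EG) ∞
      (Function.uncurry fun m k => μ (k, q m)) (n, p n) :=
    ContMDiffAt.comp (n, p n) (g := μ) (f := fun z : N × G => (z.2, q z.1)) hμ
      (contMDiffAt_snd.prodMk (hq.comp (n, p n) contMDiffAt_fst))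
  have hc : ContinuousAt (fun m => (p m, q m)) n := hp.continuousAt.prodMk hq.continuousAt
  have hμd : ∀ᶠ z in 𝓝 (p n, q n), ContMDiffAt (𝓘(ℝ, EG).prod 𝓘(ℝ, EG)) 𝓘(ℝ, EG) 1 μ z :=
    (contMDiffAt_iff_contMDiffAt_nhds (by simp)).1 (hμ.of_le (by simp))
  refine (contMDiffAt_modelDeriv_apply hν hX).congr_of_eventuallyEq ?_
  filter_upwards [hpq, hsX, hc.eventually hμd, hc.eventually hμm.eventually_nhds]
    with m h1 h2 h3 h4
  have h3' := h3.mdifferentiableAt one_ne_zero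
  rw [dmul_eq_modelDeriv h3' h4 h1 (by rw [h2, map_zero]), ← modelDeriv_partial_left h3',
    h4.self_of_nhds h1]

theorem contMDiffAt_dmul_right {p q : N → G} {X : N → EG} {n : N}
    (hp : ContMDiffAt 𝓘(ℝ, F) 𝓘(ℝ, EG) ∞ p n)
    (hX : ContMDiffAt 𝓘(ℝ, F) 𝓘(ℝ, EG).tangent ∞
      (fun m => (⟨q m, X m⟩ : TangentBundle 𝓘(ℝ, EG) G)) n)
    (hpq : ∀ᶠ m in 𝓝 n, Γ.src (p m) = Γ.tgt (q m))
    (htX : ∀ᶠ m in 𝓝 n, Γ.dtgt (q m) (X m) = 0) :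
    ContMDiffAt 𝓘(ℝ, F) 𝓘(ℝ, EG).tangent ∞
      (fun m => (⟨Γ.mul (p m) (q m), Γ.dmul (p m) (q m) (0, X m)⟩ :
        TangentBundle 𝓘(ℝ, EG) G)) n := by
  obtain ⟨μ, hμ, hμm⟩ := exists_mul_extension hpq.self_of_nhds
  have hq : ContMDiffAt 𝓘(ℝ, F) 𝓘(ℝ, EG) ∞ q n := by
    rw [Bundle.contMDiffAt_totalSpace] at hX
    exact hX.1
  have hν : ContMDiffAt (𝓘(ℝ, F).prod 𝓘(ℝ, EG)) 𝓘(ℝ, EG) ∞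
      (Function.uncurry fun m k => μ (p m, k)) (n, q n) :=
    ContMDiffAt.comp (n, q n) (g := μ) (f := fun z : N × G => (p z.1, z.2)) hμ
      ((hp.comp (n, q n) contMDiffAt_fst).prodMk contMDiffAt_snd)
  have hc : ContinuousAt (fun m => (p m, q m)) n := hp.continuousAt.prodMk hq.continuousAt
  have hμd : ∀ᶠ z in 𝓝 (p n, q n), ContMDiffAt (𝓘(ℝ, EG).prod 𝓘(ℝ, EG)) 𝓘(ℝ, EG) 1 μ z :=
    (contMDiffAt_iff_contMDiffAt_nhds (by simp)).1 (hμ.of_le (by simp))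
  refine (contMDiffAt_modelDeriv_apply hν hX).congr_of_eventuallyEq ?_
  filter_upwards [hpq, htX, hc.eventually hμd, hc.eventually hμm.eventually_nhds]
    with m h1 h2 h3 h4
  have h3' := h3.mdifferentiableAt one_ne_zero
  rw [dmul_eq_modelDeriv h3' h4 h1 (by rw [h2, map_zero]), ← modelDeriv_partial_right h3',
    h4.self_of_nhds h1]

end Smooth

theorem SmoothOn.contMDiffAt {X : ∀ x, Γ.UnitTangent x} {U : Set M} (hX : Γ.SmoothOn X U) {x : M}
    (hU : U ∈ 𝓝 x) : ContMDiffAt 𝓘(ℝ, EM) 𝓘(ℝ, EG).tangent ∞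
      (fun x => (⟨Γ.unit x, X x⟩ : TangentBundle 𝓘(ℝ, EG) G)) x :=
  ContMDiffOn.contMDiffAt hX hU

/-- The right invariant vector field of a smooth section of the algebroid is smooth. -/
theorem contMDiffAt_rightInvariant {X : ∀ x, Γ.UnitTangent x} (hX : Γ.SmoothOn X univ)
    (hXA : ∀ x, X x ∈ Γ.algebroid x) (g : G) :
    ContMDiffAt 𝓘(ℝ, EG) 𝓘(ℝ, EG).tangent ∞
      (fun g => (⟨g, Γ.rightInvariant X g⟩ : TangentBundle 𝓘(ℝ, EG) G)) g := by
  have h1 : ContMDiffAt 𝓘(ℝ, EG) 𝓘(ℝ, EG).tangent ∞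
      (fun g => (⟨Γ.unit (Γ.tgt g), X (Γ.tgt g)⟩ : TangentBundle 𝓘(ℝ, EG) G)) g :=
    (hX.contMDiffAt (x := Γ.tgt g) Filter.univ_mem).comp g (Γ.contMDiff_tgt g)
  have h2 := contMDiffAt_dmul_left (Γ := Γ) (q := id) h1 contMDiffAt_id
    (.of_forall fun g => Γ.src_unit _) (.of_forall fun g => hXA (Γ.tgt g))
  refine h2.congr_of_eventuallyEq (.of_forall fun g => ?_)
  simp only [id]
  rw [Γ.unit_mul, rightInvariant_eq (hXA _)]

/-- The adjoint action on a smooth isotropy section is smooth. -/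
theorem contMDiffAt_Ad {Y : ∀ x, Γ.UnitTangent x} {U : Set M} (hU : IsOpen U)
    (hY : Γ.SmoothOn Y U) (hYI : ∀ x ∈ U, Y x ∈ Γ.isotropy x) {g : G} (hg : Γ.src g ∈ U) :
    ContMDiffAt 𝓘(ℝ, EG) 𝓘(ℝ, EG).tangent ∞
      (fun g => (⟨Γ.unit (Γ.tgt g), Γ.Ad g (Y (Γ.src g))⟩ : TangentBundle 𝓘(ℝ, EG) G)) g := by
  have hUg : ∀ᶠ g in 𝓝 g, Γ.src g ∈ U :=
    Γ.contMDiff_src.continuous.continuousAt.eventually (hU.mem_nhds hg)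
  have h1 : ContMDiffAt 𝓘(ℝ, EG) 𝓘(ℝ, EG).tangent ∞
      (fun g => (⟨Γ.unit (Γ.src g), Y (Γ.src g)⟩ : TangentBundle 𝓘(ℝ, EG) G)) g :=
    (hY.contMDiffAt (hU.mem_nhds hg)).comp g (Γ.contMDiff_src g)
  have h2 := contMDiffAt_dmul_right (Γ := Γ) (p := id) contMDiffAt_id h1
    (.of_forall fun g => (Γ.tgt_unit _).symm) (hUg.mono fun g hg => (hYI _ hg).2)
  have h2' : ContMDiffAt 𝓘(ℝ, EG) 𝓘(ℝ, EG).tangent ∞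
      (fun g => (⟨g, Γ.dmul g (Γ.unit (Γ.src g)) ((0 : EG), (Y (Γ.src g) : EG))⟩ :
        TangentBundle 𝓘(ℝ, EG) G)) g := by
    refine h2.congr_of_eventuallyEq (.of_forall fun g => ?_)
    simp only [id]
    rw [Γ.mul_unit]
  have h3 := contMDiffAt_dmul_left (Γ := Γ) (q := Γ.inv) h2' (Γ.smooth_inv g)
    (.of_forall fun g => (Γ.tgt_inv _).symm) (hUg.mono fun g hg => dsrc_dmul_unit (hYI _ hg))
  refine h3.congr_of_eventuallyEq (.of_forall fun g => ?_)
  beta_reduce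
  rw [Γ.mul_inv]
  rfl

end LieGroupoid

/-! ### Tangent vectors read in a preferred chart. -/

section TangentCoordinates

variable {F : Type*} [NormedAddCommGroup F] [NormedSpace ℝ F] {N : Type*} [TopologicalSpace N]
  [ChartedSpace F N]
  {E : Type*} [NormedAddCommGroup E] [NormedSpace ℝ E] {K : Type*} [TopologicalSpace K]
  [ChartedSpace E K]

/-- The derivative at `y` of the preferred chart at `x`. -/
noncomputable def chartDeriv (x y : K) : E →L[ℝ] E :=
  modelDeriv 𝓘(ℝ, E) 𝓘(ℝ, E) (extChartAt 𝓘(ℝ, E) x) y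

theorem chartDeriv_modelSpace (x y : E) : chartDeriv x y = ContinuousLinearMap.id ℝ E := by
  rw [chartDeriv, extChartAt_model_space_eq_id]
  exact mfderiv_id

variable [IsManifold 𝓘(ℝ, E) ∞ K]

theorem chartDeriv_self (x : K) : chartDeriv x x = ContinuousLinearMap.id ℝ E :=
  mfderiv_extChartAt_self (I := 𝓘(ℝ, E)) (x := x)

theorem HasVelocity.hasDerivAt_extChartAt {c : ℝ → K} {v : E} (hc : HasVelocity 𝓘(ℝ, E) c v)
    {x : K} (hx : c 0 = x) : HasDerivAt (fun t => extChartAt 𝓘(ℝ, E) x (c t)) v 0 := by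
  have h1 := hasVelocity_iff_hasDerivAt.1 (hc.comp hx
    (mdifferentiableAt_extChartAt (I := 𝓘(ℝ, E)) (mem_chart_source E x)))
  have h2 : modelDeriv 𝓘(ℝ, E) 𝓘(ℝ, E) (extChartAt 𝓘(ℝ, E) x) x v = v :=
    DFunLike.congr_fun (chartDeriv_self x) v
  rwa [h2] at h1

/-- The trivialization of the tangent bundle at `b n` is, near `b n`, the derivative of the
preferred chart there. This reduces smooth sections to maps into a fixed vector space. -/
theorem contMDiffAt_tangent_iff {b : N → K} {X : N → E} {n : N} :
    ContMDiffAt 𝓘(ℝ, F) 𝓘(ℝ, E).tangent ∞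
      (fun m => (⟨b m, X m⟩ : TangentBundle 𝓘(ℝ, E) K)) n ↔
    ContMDiffAt 𝓘(ℝ, F) 𝓘(ℝ, E) ∞ b n ∧
      ContMDiffAt 𝓘(ℝ, F) 𝓘(ℝ, E) ∞ (fun m => chartDeriv (b n) (b m) (X m)) n := by
  rw [Bundle.contMDiffAt_totalSpace]
  refine and_congr_right fun hb => Filter.EventuallyEq.contMDiffAt_iff ?_
  have h1 : ∀ᶠ m in 𝓝 n, b m ∈ (chartAt E (b n)).source :=
    hb.continuousAt.eventually ((chartAt E (b n)).open_source.mem_nhds (mem_chart_source E (b n)))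
  filter_upwards [h1] with m hm
  have h2 := TangentBundle.continuousLinearMapAt_trivializationAt (I := 𝓘(ℝ, E)) hm
  have h3 := DFunLike.congr_fun h2 (X m)
  refine Eq.trans ?_ h3
  exact (congrFun (Bundle.Trivialization.coe_linearMapAt_of_mem (R := ℝ)
    (trivializationAt E (TangentSpace 𝓘(ℝ, E)) (b n)) (b := b m) (by simpa using hm)) (X m)).symm

end TangentCoordinates

/-! ### The commutator of vector fields in a chart. -/

section Bracket

variable {E : Type*} [NormedAddCommGroup E] [NormedSpace ℝ E]

/-- The commutator of two vector fields that are given along curves by the two partial derivatives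
of a map `m`. -/
theorem fderiv_sub_fderiv_of_partial {m : E × E → E} {p x y z : E} (hm : ContDiffAt ℝ 2 m (p, p))
    {V W : E → E} (hV : DifferentiableAt ℝ V p) (hW : DifferentiableAt ℝ W p)
    {h γ Z : ℝ → E} (h0 : h 0 = p) (hh : HasDerivAt h y 0) (γ0 : γ 0 = p)
    (hγ : HasDerivAt γ x 0) (hZ0 : Z 0 = y) (hZ : HasDerivAt Z z 0)
    (hVh : ∀ᶠ t in 𝓝 0, V (h t) = fderiv ℝ m (p, h t) (x, 0))
    (hWγ : ∀ᶠ t in 𝓝 0, W (γ t) = fderiv ℝ m (γ t, p) (0, Z t)) :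
    fderiv ℝ W p x - fderiv ℝ V p y = fderiv ℝ m (p, p) (0, z) := by
  have hd : DifferentiableAt ℝ (fderiv ℝ m) (p, p) :=
    (hm.fderiv_right (m := 1) (by norm_num)).differentiableAt one_ne_zero
  have hsymm : IsSymmSndFDerivAt ℝ m (p, p) := hm.isSymmSndFDerivAt (by simp)
  have hV1 : HasDerivAt (fun t => V (h t)) (fderiv ℝ V p y) 0 := by
    have : HasFDerivAt V (fderiv ℝ V p) (h 0) := by rw [h0]; exact hV.hasFDerivAt
    exact this.comp_hasDerivAt 0 hh
  have hW1 : HasDerivAt (fun t => W (γ t)) (fderiv ℝ W p x) 0 := by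
    have : HasFDerivAt W (fderiv ℝ W p) (γ 0) := by rw [γ0]; exact hW.hasFDerivAt
    exact this.comp_hasDerivAt 0 hγ
  have hV2 : HasDerivAt (fun t => fderiv ℝ m (p, h t) (x, 0))
      (fderiv ℝ (fderiv ℝ m) (p, p) (0, y) (x, 0)) 0 := by
    have h1 : HasFDerivAt (fderiv ℝ m) (fderiv ℝ (fderiv ℝ m) (p, p)) (p, h 0) := by
      rw [h0]; exact hd.hasFDerivAt
    have h2 : HasDerivAt (fun t => (p, h t)) ((0 : E), y) 0 := (hasDerivAt_const _ _).prodMk hh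
    have h3 := h1.comp_hasDerivAt 0 h2
    simpa using h3.clm_apply (hasDerivAt_const (0 : ℝ) (x, (0 : E)))
  have hW2 : HasDerivAt (fun t => fderiv ℝ m (γ t, p) (0, Z t))
      (fderiv ℝ (fderiv ℝ m) (p, p) (x, 0) (0, y) + fderiv ℝ m (p, p) (0, z)) 0 := by
    have h1 : HasFDerivAt (fderiv ℝ m) (fderiv ℝ (fderiv ℝ m) (p, p)) (γ 0, p) := by
      rw [γ0]; exact hd.hasFDerivAt
    have h2 : HasDerivAt (fun t => (γ t, p)) (x, (0 : E)) 0 := hγ.prodMk (hasDerivAt_const _ _)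
    have h3 := h1.comp_hasDerivAt 0 h2
    have h4 : HasDerivAt (fun t => ((0 : E), Z t)) ((0 : E), z) 0 :=
      (hasDerivAt_const _ _).prodMk hZ
    have h5 := h3.clm_apply h4
    simpa [γ0, hZ0] using h5
  have e1 := (hV2.congr_of_eventuallyEq hVh).unique hV1
  have e2 := (hW2.congr_of_eventuallyEq hWγ).unique hW1
  -- The mixed second derivative of `m` appears once in each term; symmetry cancels it and only the
  -- derivative of `Z` survives.
  rw [← e1, ← e2, hsymm (0, y) (x, 0)]
  abel

variable {K : Type*} [TopologicalSpace K] [ChartedSpace E K]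

/-- A vector field read in the preferred chart at `x`. -/
noncomputable def inChart (x : K) (V : ∀ k : K, TangentSpace 𝓘(ℝ, E) k) (b : E) : E :=
  chartDeriv x ((extChartAt 𝓘(ℝ, E) x).symm b) (V ((extChartAt 𝓘(ℝ, E) x).symm b))

theorem inChart_apply {x k : K} (hk : k ∈ (chartAt E x).source)
    (V : ∀ k : K, TangentSpace 𝓘(ℝ, E) k) :
    inChart x V (extChartAt 𝓘(ℝ, E) x k) = chartDeriv (E := E) x k (V k) := by
  have hk' : k ∈ (extChartAt 𝓘(ℝ, E) x).source := by simpa using hk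
  rw [inChart, (extChartAt 𝓘(ℝ, E) x).left_inv hk']

variable [IsManifold 𝓘(ℝ, E) ∞ K]

theorem inChart_eq_mpullbackWithin {x : K} {b : E} (hb : b ∈ (extChartAt 𝓘(ℝ, E) x).target)
    (V : ∀ k : K, TangentSpace 𝓘(ℝ, E) k) :
    VectorField.mpullbackWithin 𝓘(ℝ, E) 𝓘(ℝ, E) (extChartAt 𝓘(ℝ, E) x).symm V
      (range 𝓘(ℝ, E)) b = inChart x V b := by
  let A : E →L[ℝ] E := mfderivWithin 𝓘(ℝ, E) 𝓘(ℝ, E) (extChartAt 𝓘(ℝ, E) x).symm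
    (range 𝓘(ℝ, E)) b
  let B : E →L[ℝ] E := chartDeriv x ((extChartAt 𝓘(ℝ, E) x).symm b)
  have h1 : B.comp A = ContinuousLinearMap.id ℝ E :=
    mfderiv_extChartAt_comp_mfderivWithin_extChartAt_symm (I := 𝓘(ℝ, E)) hb
  have h2 : A.comp B = ContinuousLinearMap.id ℝ E :=
    mfderivWithin_extChartAt_symm_comp_mfderiv_extChartAt (I := 𝓘(ℝ, E)) hb
  have h3 : A.inverse = B := ContinuousLinearMap.inverse_eq h2 h1
  exact DFunLike.congr_fun h3 (V ((extChartAt 𝓘(ℝ, E) x).symm b))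

/-- The bracket is defined by pulling back to the chart at `x` and returning by the inverse of its
derivative at `x`, which is the identity in the preferred chart. -/
theorem mlieBracket_eq_inChart (x : K) (V W : ∀ k : K, TangentSpace 𝓘(ℝ, E) k) :
    (VectorField.mlieBracket 𝓘(ℝ, E) V W x : E) =
      VectorField.lieBracket ℝ (inChart x V) (inChart x W) (extChartAt 𝓘(ℝ, E) x x) := by
  have h1 : mfderiv 𝓘(ℝ, E) 𝓘(ℝ, E) (extChartAt 𝓘(ℝ, E) x) x = ContinuousLinearMap.id ℝ E :=
    mfderiv_extChartAt_self
  have h2 : ContinuousLinearMap.inverse (ContinuousLinearMap.id ℝ E) =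
      ContinuousLinearMap.id ℝ E := ContinuousLinearMap.inverse_id
  have h3 : ∀ U : ∀ k : K, TangentSpace 𝓘(ℝ, E) k,
      VectorField.mpullbackWithin 𝓘(ℝ, E) 𝓘(ℝ, E) (extChartAt 𝓘(ℝ, E) x).symm U
        (range 𝓘(ℝ, E)) =ᶠ[𝓝 (extChartAt 𝓘(ℝ, E) x x)] inChart x U := fun U => by
    filter_upwards [extChartAt_target_mem_nhds (I := 𝓘(ℝ, E)) x] with b hb
      using inChart_eq_mpullbackWithin hb U
  let V' : E → E := VectorField.mpullbackWithin 𝓘(ℝ, E) 𝓘(ℝ, E)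
    (extChartAt 𝓘(ℝ, E) x).symm V (range 𝓘(ℝ, E))
  let W' : E → E := VectorField.mpullbackWithin 𝓘(ℝ, E) 𝓘(ℝ, E)
    (extChartAt 𝓘(ℝ, E) x).symm W (range 𝓘(ℝ, E))
  let L : E := VectorField.lieBracketWithin ℝ V' W'
    ((extChartAt 𝓘(ℝ, E) x).symm ⁻¹' univ ∩ range 𝓘(ℝ, E)) (extChartAt 𝓘(ℝ, E) x x)
  have h4 : L = VectorField.lieBracket ℝ (inChart x V) (inChart x W) (extChartAt 𝓘(ℝ, E) x x) := by
    simp only [L]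
    rw [show ((extChartAt 𝓘(ℝ, E) x).symm ⁻¹' univ ∩ range 𝓘(ℝ, E)) = univ by simp,
      VectorField.lieBracketWithin_univ]
    exact Filter.EventuallyEq.lieBracket_vectorField_eq (h3 V) (h3 W)
  have h5 : VectorField.mlieBracket 𝓘(ℝ, E) V W x = ContinuousLinearMap.inverse
      (mfderiv 𝓘(ℝ, E) 𝓘(ℝ, E) (extChartAt 𝓘(ℝ, E) x) x) L := by
    rw [← VectorField.mlieBracketWithin_univ, VectorField.mlieBracketWithin_apply]
  exact ((h5.trans (DFunLike.congr_fun (congrArg ContinuousLinearMap.inverse h1) _)).trans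
    (DFunLike.congr_fun h2 _)).trans h4

theorem differentiableAt_inChart {x : K} {V : ∀ k : K, TangentSpace 𝓘(ℝ, E) k}
    (hV : ContMDiffAt 𝓘(ℝ, E) 𝓘(ℝ, E).tangent ∞
      (fun k => (⟨k, V k⟩ : TangentBundle 𝓘(ℝ, E) K)) x) :
    DifferentiableAt ℝ (inChart x V) (extChartAt 𝓘(ℝ, E) x x) := by
  have h1 := (contMDiffAt_tangent_iff.1 hV).2
  have h2 : ContMDiffAt 𝓘(ℝ, E) 𝓘(ℝ, E) ∞ (extChartAt 𝓘(ℝ, E) x).symm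
      (extChartAt 𝓘(ℝ, E) x x) :=
    (contMDiffOn_extChartAt_symm x).contMDiffAt (extChartAt_target_mem_nhds x)
  have h3 : ContMDiffAt 𝓘(ℝ, E) 𝓘(ℝ, E) ∞ (inChart x V) (extChartAt 𝓘(ℝ, E) x x) :=
    h1.comp_of_eq h2 (extChartAt_to_inv x)
  exact h3.contDiffAt.differentiableAt (by simp)

end Bracket

/-! ### The derivative of the adjoint action is the bracket. -/

namespace LieGroupoid

variable {EM : Type*} [NormedAddCommGroup EM] [NormedSpace ℝ EM]
  {EG : Type*} [NormedAddCommGroup EG] [NormedSpace ℝ EG]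
  {M : Type*} [TopologicalSpace M] [ChartedSpace EM M] [IsManifold 𝓘(ℝ, EM) ∞ M]
  {G : Type*} [TopologicalSpace G] [ChartedSpace EG G] [IsManifold 𝓘(ℝ, EG) ∞ G]
  {Γ : LieGroupoid EM EG M G}

theorem contMDiffAt_chartDeriv_Ad {Y : ∀ x, Γ.UnitTangent x} {U : Set M} (hU : IsOpen U)
    (hY : Γ.SmoothOn Y U) (hYI : ∀ x ∈ U, Y x ∈ Γ.isotropy x) {g : G} (hg : Γ.src g ∈ U) {x : M}
    (hx : Γ.tgt g = x) :
    ContMDiffAt 𝓘(ℝ, EG) 𝓘(ℝ, EG) ∞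
      (fun h => chartDeriv (Γ.unit x) (Γ.unit (Γ.tgt h)) (Γ.Ad h (Y (Γ.src h)))) g := by
  subst hx
  exact (contMDiffAt_tangent_iff.1 (contMDiffAt_Ad hU hY hYI hg)).2

/-- Along a curve of arrows ending at `x`, the transport of a smooth isotropy section to `x` is
differentiable. -/
theorem exists_hasDerivAt_Ad {Y : ∀ x, Γ.UnitTangent x} {U : Set M} (hU : IsOpen U)
    (hY : Γ.SmoothOn Y U) (hYI : ∀ x ∈ U, Y x ∈ Γ.isotropy x) {c : ℝ → G} {v : EG} {x : M}
    (hc : HasVelocity 𝓘(ℝ, EG) c v) (hcU : Γ.src (c 0) ∈ U) (hcx : ∀ᶠ t in 𝓝 0, Γ.tgt (c t) = x) :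
    ∃ z, HasDerivAt (fun t => Γ.Ad (c t) (Y (Γ.src (c t)))) z 0 := by
  have h1 := contMDiffAt_chartDeriv_Ad hU hY hYI hcU hcx.self_of_nhds
  have h2 := hc.comp rfl (h1.mdifferentiableAt (by simp))
  refine ⟨_, (hasVelocity_iff_hasDerivAt.1 h2).congr_of_eventuallyEq ?_⟩
  filter_upwards [hcx] with t ht
  -- All values lie in the one tangent space at the unit over `x`, where the chart derivative is the
  -- identity.
  rw [ht, chartDeriv_self]
  rfl

theorem hasVelocity_inv {c : ℝ → G} {v : EG} (hc : HasVelocity 𝓘(ℝ, EG) c v) :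
    HasVelocity 𝓘(ℝ, EG) (fun t => Γ.inv (c t)) (modelDeriv 𝓘(ℝ, EG) 𝓘(ℝ, EG) Γ.inv (c 0) v) :=
  hc.comp rfl (Γ.smooth_inv.mdifferentiable (by simp) _)

theorem rightInvariant_unit {X : ∀ x, Γ.UnitTangent x} {x : M} (hX : X x ∈ Γ.algebroid x) :
    (Γ.rightInvariant X (Γ.unit x) : EG) = X x := by
  have ht := Γ.tgt_unit x
  rw [rightInvariant_eq (by rw [ht]; exact hX), ht]
  have := dmul_unit_right (Γ := Γ) (g := Γ.unit x) (u := X x) hX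
  rwa [Γ.src_unit] at this

/-- The derivative of the adjoint action on an isotropy section is the Lie algebroid bracket. -/
theorem hasDerivAt_Ad_inv {X Y : ∀ x, Γ.UnitTangent x} (hX : Γ.SmoothOn X univ)
    (hXA : ∀ x, X x ∈ Γ.algebroid x) (hY : Γ.SmoothOn Y univ)
    (hYI : ∀ x, Y x ∈ Γ.isotropy x) {x : M} {γ : ℝ → G} (γ0 : γ 0 = Γ.unit x)
    (hγ : HasVelocity 𝓘(ℝ, EG) γ (X x)) (hs : ∀ᶠ t in 𝓝 0, Γ.src (γ t) = x) :
    HasDerivAt (fun t => Γ.Ad (Γ.inv (γ t)) (Y (Γ.tgt (γ t)))) (Γ.bracket X Y x) 0 := by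
  set e := Γ.unit x with he
  have hte : Γ.tgt e = x := Γ.tgt_unit x
  have hse : Γ.src e = x := Γ.src_unit x
  have hue : Γ.unit (Γ.src e) = e := by rw [hse]
  set Z : ℝ → EG := fun t => Γ.Ad (Γ.inv (γ t)) (Y (Γ.tgt (γ t))) with hZdef
  -- the transported section is differentiable, with derivative tangent to the target fibre
  obtain ⟨z, hz⟩ : ∃ z, HasDerivAt Z z 0 := by
    obtain ⟨z, h1⟩ := exists_hasDerivAt_Ad isOpen_univ hY (fun x _ => hYI x) (hasVelocity_inv (Γ := Γ) hγ)
      (mem_univ _) (by filter_upwards [hs] with t ht using (Γ.tgt_inv _).trans ht)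
    refine ⟨z, h1.congr_of_eventuallyEq (.of_forall fun t => ?_)⟩
    simp only [hZdef]
    rw [Γ.src_inv]
  have hZI : ∀ᶠ t in 𝓝 0, Z t ∈ Γ.isotropy x := by
    filter_upwards [hs] with t ht
    have := Ad_mem (EG := EG) (Γ := Γ) (g := Γ.inv (γ t)) (v := Y (Γ.tgt (γ t)))
      (by rw [Γ.src_inv]; exact hYI _)
    rwa [Γ.tgt_inv, ht] at this
  have hZ0 : Z 0 = Y x := by
    simp only [hZdef]
    rw [γ0, he, Γ.inv_unit, Γ.tgt_unit, Ad_unit (EG := EG) (hYI x)]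
  have hze : Γ.dtgt e z = 0 := by
    have h1 : HasDerivAt (fun t => Γ.dtgt e (Z t)) (Γ.dtgt e z) 0 :=
      (Γ.dtgt e).hasFDerivAt.comp_hasDerivAt 0 hz
    refine h1.unique ((hasDerivAt_const (0 : ℝ) (0 : EM)).congr_of_eventuallyEq ?_)
    filter_upwards [hZI] with t ht using ht.2
  suffices h : Γ.bracket X Y x = z by rw [h]; exact hz
  -- the multiplication in the preferred chart at the unit
  obtain ⟨μ, hμ, hμm⟩ := exists_mul_extension (Γ := Γ) (g := e) (h := e) (hse.trans hte.symm)
  have hee : Γ.mul e e = e := by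
    have := Γ.mul_unit e
    rwa [hue] at this
  have hμe : μ (e, e) = e := (hμm.self_of_nhds (hse.trans hte.symm)).trans hee
  set φ := extChartAt 𝓘(ℝ, EG) e with hφ
  let m : EG × EG → EG := fun p => φ (μ (φ.symm p.1, φ.symm p.2))
  have hmul_smooth : ContDiffAt ℝ ∞ m (φ e, φ e) := by
    have h1 : ContMDiffAt 𝓘(ℝ, EG) 𝓘(ℝ, EG) ∞ φ.symm (φ e) :=
      (contMDiffOn_extChartAt_symm e).contMDiffAt (extChartAt_target_mem_nhds e)
    have h2 : ContMDiffAt 𝓘(ℝ, EG × EG) (𝓘(ℝ, EG).prod 𝓘(ℝ, EG)) ∞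
        (fun p : EG × EG => (φ.symm p.1, φ.symm p.2)) (φ e, φ e) :=
      (h1.comp (φ e, φ e) contDiffAt_fst.contMDiffAt).prodMk
        (h1.comp (φ e, φ e) contDiffAt_snd.contMDiffAt)
    have h3 : ContMDiffAt 𝓘(ℝ, EG) 𝓘(ℝ, EG) ∞ φ e := contMDiffAt_extChartAt
    have h4 := hμ.comp_of_eq h2 (by simp [φ])
    exact (h3.comp_of_eq h4 (by simp [φ, hμe])).contDiffAt
  have hφs : ∀ᶠ k in 𝓝 e, k ∈ (chartAt EG e).source :=
    (chartAt EG e).open_source.mem_nhds (mem_chart_source EG e)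
  have hφd : ∀ k ∈ (chartAt EG e).source, MDifferentiableAt 𝓘(ℝ, EG) 𝓘(ℝ, EG) φ k :=
    fun k hk => mdifferentiableAt_extChartAt hk
  have hφc : ContinuousAt φ e := continuousAt_extChartAt e
  -- the derivative of the multiplication in the chart
  have hchart : ∀ᶠ q in 𝓝 (e, e), Γ.src q.1 = Γ.tgt q.2 → ∀ u w : EG,
      Γ.dsrc q.1 u = Γ.dtgt q.2 w →
      fderiv ℝ m (φ q.1, φ q.2) (chartDeriv e q.1 u, chartDeriv e q.2 w) =
        chartDeriv e (Γ.mul q.1 q.2) (Γ.dmul q.1 q.2 (u, w)) := by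
    have h1 : ∀ᶠ q in 𝓝 (e, e), ContMDiffAt (𝓘(ℝ, EG).prod 𝓘(ℝ, EG)) 𝓘(ℝ, EG) 1 μ q :=
      (contMDiffAt_iff_contMDiffAt_nhds (by simp)).1 (hμ.of_le (by simp))
    have h2 : ∀ᶠ q : G × G in 𝓝 (e, e), μ q ∈ (chartAt EG e).source :=
      hμ.continuousAt.eventually (by rwa [hμe])
    have h3 : ∀ᶠ q : G × G in 𝓝 (e, e), DifferentiableAt ℝ m (φ q.1, φ q.2) := by
      have h4 : ∀ᶠ p in 𝓝 (φ e, φ e), DifferentiableAt ℝ m p := by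
        filter_upwards [(hmul_smooth.of_le (m := 1) (by simp)).eventually (by simp)] with p hp
          using hp.differentiableAt one_ne_zero
      have h5 : ContinuousAt (fun q : G × G => (φ q.1, φ q.2)) (e, e) :=
        (hφc.comp_of_eq continuousAt_fst rfl).prodMk (hφc.comp_of_eq continuousAt_snd rfl)
      exact h5.eventually h4
    have h6 : ∀ᶠ q : G × G in 𝓝 (e, e), q.1 ∈ (chartAt EG e).source :=
      continuousAt_fst.eventually hφs
    have h7 : ∀ᶠ q : G × G in 𝓝 (e, e), q.2 ∈ (chartAt EG e).source :=
      continuousAt_snd.eventually hφs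
    filter_upwards [h1, h2, h3, h6, h7, hμm.eventually_nhds]
    rintro ⟨g, k⟩ h1 h2 h3 h6 h7 h8 hgk u w huw
    have h1' := h1.mdifferentiableAt one_ne_zero
    rw [dmul_eq_modelDeriv h1' h8 hgk huw, ← h8.self_of_nhds hgk]
    obtain ⟨a, rfl, ha⟩ := exists_hasVelocity g u
    obtain ⟨b, rfl, hb⟩ := exists_hasVelocity k w
    have v1 : HasVelocity 𝓘(ℝ, EG) (fun t => φ (μ (a t, b t))) _ :=
      ((ha.prodMk hb).comp rfl h1').comp rfl (hφd _ h2)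
    have v2 : HasDerivAt (fun t => (φ (a t), φ (b t))) (chartDeriv e (a 0) u, chartDeriv e (b 0) w)
        0 := (hasVelocity_iff_hasDerivAt.1 (ha.comp rfl (hφd _ h6))).prodMk
          (hasVelocity_iff_hasDerivAt.1 (hb.comp rfl (hφd _ h7)))
    have v3 := h3.hasFDerivAt.comp_hasDerivAt (0 : ℝ) v2
    refine v3.unique ((hasVelocity_iff_hasDerivAt.1 v1).congr_of_eventuallyEq ?_)
    filter_upwards [ha.continuousAt.eventually ((chartAt EG e).open_source.mem_nhds h6),
      hb.continuousAt.eventually ((chartAt EG e).open_source.mem_nhds h7)] with t h9 h10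
    simp only [m, Function.comp]
    rw [φ.left_inv (by rw [hφ, extChartAt_source]; exact h9),
      φ.left_inv (by rw [hφ, extChartAt_source]; exact h10)]
  -- a curve in the target fibre with velocity `Y x`
  obtain ⟨h, h0, hh, hth⟩ := exists_lift_tgt (Γ := Γ) (g := e) (u := Y x) (b := fun _ => x)
    hte.symm (.const x) (hYI x).2
  have hhc : ContinuousAt (fun t => (e, h t)) 0 := continuousAt_const.prodMk hh.continuousAt
  have hγc : ContinuousAt (fun t => (γ t, e)) 0 := hγ.continuousAt.prodMk continuousAt_const
  have hXs := contMDiffAt_rightInvariant hX hXA e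
  have hYA : ∀ x, Y x ∈ Γ.algebroid x := fun x => (hYI x).1
  have hYs := contMDiffAt_rightInvariant hY hYA e
  have hch : HasDerivAt (fun t => φ (h t)) (Y x : EG) 0 := hh.hasDerivAt_extChartAt h0
  have hcγ : HasDerivAt (fun t => φ (γ t)) (X x : EG) 0 := hγ.hasDerivAt_extChartAt γ0
  -- Because `h` stays in the target fibre over `x`, the right invariant field along it translates
  -- the constant vector `X x`.
  have hVh : ∀ᶠ t in 𝓝 0, inChart e (Γ.rightInvariant X) (φ (h t)) =
      fderiv ℝ m (φ e, φ (h t)) ((X x : EG), 0) := by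
    have hs1 : ∀ᶠ k in 𝓝 (h 0), k ∈ (chartAt EG e).source := by rwa [h0]
    have hs2 := hchart
    rw [show (e, e) = (e, h 0) by rw [h0]] at hs2
    filter_upwards [hth, hh.continuousAt.eventually hs1, hhc.eventually hs2] with t h1 h2 h3
    have h4 := h3 (hse.trans h1.symm) (X x) 0 (by rw [map_zero]; exact hXA x)
    rw [chartDeriv_self, map_zero] at h4
    rw [inChart_apply h2, rightInvariant_eq (hXA _), h1]
    refine Eq.trans ?_ h4.symm
    have h5 : Γ.mul e (h t) = h t := by rw [he, ← h1, Γ.unit_mul]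
    rw [h5]
  -- Here the target varies, so the right translate is rewritten as a left translate of `Z t`, a
  -- vector at the fixed unit `e`; this is the other partial derivative of `m`.
  have hWγ : ∀ᶠ t in 𝓝 0, inChart e (Γ.rightInvariant Y) (φ (γ t)) =
      fderiv ℝ m (φ (γ t), φ e) (0, Z t) := by
    have hs1 : ∀ᶠ k in 𝓝 (γ 0), k ∈ (chartAt EG e).source := by rwa [γ0]
    have hs2 := hchart
    rw [show (e, e) = (γ 0, e) by rw [γ0]] at hs2
    filter_upwards [hs, hγ.continuousAt.eventually hs1, hγc.eventually hs2, hZI]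
      with t h1 h2 h3 h4
    have h5 := h3 (h1.trans hte.symm) 0 (Z t) (by rw [map_zero]; exact h4.2.symm)
    rw [chartDeriv_self, map_zero] at h5
    rw [inChart_apply h2, rightInvariant_eq (hYA _), dmul_right_eq_left (EG := EG) (hYI _), h1]
    refine Eq.trans ?_ h5.symm
    have h6 : Γ.mul (γ t) e = γ t := by rw [he, ← h1, Γ.mul_unit]
    rw [h6]
  have key := fderiv_sub_fderiv_of_partial (hmul_smooth.of_le (m := 2) ENat.LEInfty.out)
    (differentiableAt_inChart hXs) (differentiableAt_inChart hYs)
    (h := fun t => φ (h t)) (γ := fun t => φ (γ t)) (Z := Z) (by simp only [h0]) hch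
    (by simp only [γ0]) hcγ hZ0 hz hVh hWγ
  have hlast : fderiv ℝ m (φ e, φ e) (0, z) = z := by
    have h1 := hchart.self_of_nhds (hse.trans hte.symm) 0 z (by rw [map_zero, hze])
    rw [hee, chartDeriv_self, map_zero] at h1
    refine h1.trans ?_
    have h2 := dmul_unit_left (Γ := Γ) hze
    rwa [hte] at h2
  rw [hlast] at key
  refine Eq.trans ?_ key
  refine (mlieBracket_eq_inChart e _ _).trans ?_
  rw [VectorField.lieBracket_eq]
  have h1 : inChart e (Γ.rightInvariant X) (φ e) = X x := by
    rw [inChart_apply (mem_chart_source EG e), chartDeriv_self]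
    exact rightInvariant_unit (hXA x)
  have h2 : inChart e (Γ.rightInvariant Y) (φ e) = Y x := by
    rw [inChart_apply (mem_chart_source EG e), chartDeriv_self]
    exact rightInvariant_unit (hYA x)
  simp only [← hφ]
  rw [h1, h2]

end LieGroupoid

/-! ### Families of linear maps with locally constant range. -/

section Span

variable {F : Type*} [NormedAddCommGroup F] [NormedSpace ℝ F]
  {A : Type*} [NormedAddCommGroup A] [NormedSpace ℝ A]
  {T : Type*} [NormedAddCommGroup T] [NormedSpace ℝ T]

theorem DifferentiableAt.hasDerivAt_line_apply {W : F → A →L[ℝ] T} {v : F}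
    (hW : DifferentiableAt ℝ W v) (f : F) (a : A) :
    HasDerivAt (fun t : ℝ => W (v + t • f) a) (fderiv ℝ W v f a) 0 := by
  have hline : HasDerivAt (fun t : ℝ => v + t • f) f 0 := by
    simpa using ((hasDerivAt_id (0 : ℝ)).smul_const f).const_add v
  have h2 : HasFDerivAt W (fderiv ℝ W v) (v + (0 : ℝ) • f) := by
    rw [zero_smul, add_zero]; exact hW.hasFDerivAt
  exact ((ContinuousLinearMap.apply ℝ T a).hasFDerivAt.comp _ h2).comp_hasDerivAt (0 : ℝ) hline

variable [FiniteDimensional ℝ A] [FiniteDimensional ℝ T]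

/-- A family of injective linear maps whose derivatives take values in its own range has locally
constant range. -/
theorem eventually_range_eq_of_fderiv_mem_range {W : F → A →L[ℝ] T} {p : F}
    (hinj : Function.Injective (W p)) (hW : ∀ᶠ v in 𝓝 p, DifferentiableAt ℝ W v)
    (hW' : ∀ᶠ v in 𝓝 p, ∀ f a, fderiv ℝ W v f a ∈ (W v).range) :
    ∀ᶠ v in 𝓝 p, (W v).range = (W p).range := by
  have : CompleteSpace A := FiniteDimensional.complete ℝ A
  obtain ⟨L₀, hL₀⟩ := (W p).toLinearMap.exists_leftInverse_of_injective
    (LinearMap.ker_eq_bot.2 hinj)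
  let L : T →L[ℝ] A := LinearMap.toContinuousLinearMap L₀
  have hL : L.comp (W p) = ContinuousLinearMap.id ℝ A := by
    ext a; exact DFunLike.congr_fun hL₀ a
  let P : F → A →L[ℝ] A := fun v => L.comp (W v)
  have hPd : ∀ v, DifferentiableAt ℝ W v → DifferentiableAt ℝ P v := fun v hv =>
    (differentiableAt_const L).clm_comp hv
  have hPu : ∀ᶠ v in 𝓝 p, IsUnit (P v) := by
    have h1 : IsUnit (P p) := by
      have : P p = 1 := hL
      rw [this]; exact isUnit_one
    exact (hPd p hW.self_of_nhds).continuousAt.eventually (Units.isOpen.mem_nhds h1)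
  -- `Q v` has the range of `W v` and is normalized by `L ∘ Q v = id`. This normalization determines
  -- it from its range, so the aim is that `Q` is constant.
  let Q : F → A →L[ℝ] T := fun v => (W v).comp (Ring.inverse (P v))
  have hLQ : ∀ v, IsUnit (P v) → L.comp (Q v) = ContinuousLinearMap.id ℝ A := fun v hv =>
    Ring.mul_inverse_cancel (P v) hv
  obtain ⟨r, hr, hball⟩ := Metric.eventually_nhds_iff_ball.1 (hW.and (hW'.and hPu))
  have hinvd : ∀ v ∈ Metric.ball p r, DifferentiableAt ℝ (fun v => Ring.inverse (P v)) v := by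
    intro v hv
    obtain ⟨h1, h2, hu⟩ := hball v hv
    exact (differentiableAt_inverse hu).comp v (hPd v h1)
  have hQd : ∀ v ∈ Metric.ball p r, DifferentiableAt ℝ Q v := fun v hv =>
    (hball v hv).1.clm_comp (hinvd v hv)
  have hQ0 : ∀ v ∈ Metric.ball p r, fderiv ℝ Q v = 0 := by
    intro v hv
    obtain ⟨h1, h2, h3⟩ := hball v hv
    have hQ := (h1.hasFDerivAt.clm_comp (hinvd v hv).hasFDerivAt).fderiv
    ext f a
    -- Both terms of the product rule lie in the range of `W v`, one by hypothesis. `L` kills the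
    -- derivative of `Q` because `L ∘ Q` is constant, and `L` is injective on that range because `L
    -- ∘ W v` is invertible.
    have hmem : fderiv ℝ Q v f a ∈ (W v).range := by
      change fderiv ℝ (fun v => (W v).comp (Ring.inverse (P v))) v f a ∈ _
      rw [hQ]
      exact Submodule.add_mem _ ⟨_, rfl⟩ (h2 f _)
    have hzero : L (fderiv ℝ Q v f a) = 0 := by
      have h4 : HasFDerivAt (fun v => L.comp (Q v))
          (0 : F →L[ℝ] A →L[ℝ] A) v := by
        refine (hasFDerivAt_const (ContinuousLinearMap.id ℝ A) v).congr_of_eventuallyEq ?_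
        filter_upwards [Metric.isOpen_ball.mem_nhds hv] with v' hv' using hLQ v' (hball v' hv').2.2
      have h5 := ((hasFDerivAt_const L v).clm_comp (hQd v hv).hasFDerivAt).unique h4
      have h6 := DFunLike.congr_fun (DFunLike.congr_fun h5 f) a
      simpa using h6
    obtain ⟨b, hb⟩ := hmem
    have hb' : W v b = fderiv ℝ Q v f a := hb
    have h7 : P v b = 0 := by
      change L (W v b) = 0
      rw [hb', hzero]
    have h8 : b = 0 := by
      have h9 := DFunLike.congr_fun (Ring.inverse_mul_cancel (P v) h3) b
      change Ring.inverse (P v) (P v b) = b at h9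
      rw [← h9, h7, map_zero]
    rw [← hb', h8, map_zero]
    rfl
  filter_upwards [Metric.ball_mem_nhds p hr] with v hv
  have hconst : Q v = Q p :=
    Metric.isOpen_ball.is_const_of_fderiv_eq_zero
      (convex_ball p r).isPreconnected (fun v hv => (hQd v hv).differentiableWithinAt)
      (fun v hv => hQ0 v hv) hv (Metric.mem_ball_self hr)
  have hQp : ∀ v ∈ Metric.ball p r, (Q v).range = (W v).range := by
    intro v hv
    have h3 := (hball v hv).2.2
    apply le_antisymm
    · rintro _ ⟨a, rfl⟩
      exact ⟨_, rfl⟩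
    · rintro _ ⟨a, rfl⟩
      refine ⟨P v a, ?_⟩
      have h9 := DFunLike.congr_fun (Ring.inverse_mul_cancel (P v) h3) a
      change W v (Ring.inverse (P v) (P v a)) = W v a
      exact congrArg (W v) h9
  rw [← hQp v hv, hconst, hQp p (Metric.mem_ball_self hr)]

end Span

/-! ### Global smooth sections: cutoffs and prescribed values. -/

namespace LieGroupoid

variable {EM : Type*} [NormedAddCommGroup EM] [NormedSpace ℝ EM]
  {EG : Type*} [NormedAddCommGroup EG] [NormedSpace ℝ EG]
  {M : Type*} [TopologicalSpace M] [ChartedSpace EM M] [IsManifold 𝓘(ℝ, EM) ∞ M]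
  {G : Type*} [TopologicalSpace G] [ChartedSpace EG G] [IsManifold 𝓘(ℝ, EG) ∞ G]
  {Γ : LieGroupoid EM EG M G}

theorem t2Space_base [T2Space G] (Γ : LieGroupoid EM EG M G) : T2Space M :=
  T2Space.of_injective_continuous (f := Γ.unit)
    (fun x y h => by rw [← Γ.src_unit x, h, Γ.src_unit]) Γ.smooth_unit.continuous

theorem SmoothOn.smul {Y : ∀ x, Γ.UnitTangent x} {U : Set M} (hU : IsOpen U)
    (hY : Γ.SmoothOn Y U) {f : M → ℝ} (hf : ContMDiff 𝓘(ℝ, EM) 𝓘(ℝ, ℝ) ∞ f) :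
    Γ.SmoothOn (fun x => f x • Y x) U := by
  intro x hx
  have h1 := contMDiffAt_tangent_iff.1 (hY.contMDiffAt (hU.mem_nhds hx))
  refine (contMDiffAt_tangent_iff.2 ⟨h1.1, ?_⟩).contMDiffWithinAt
  refine ((hf x).smul h1.2).congr_of_eventuallyEq (.of_forall fun z => ?_)
  exact (chartDeriv (E := EG) (Γ.unit x) (Γ.unit z)).map_smul (f z) (Y z)

/-- Multiplication by a smooth cutoff function extends local sections to global ones. -/
theorem exists_cutoff [FiniteDimensional ℝ EM] [T2Space G] (Γ : LieGroupoid EM EG M G) {U : Set M}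
    (hU : IsOpen U) {y : M} (hy : y ∈ U) :
    ∃ f : M → ℝ, (∀ᶠ z in 𝓝 y, f z = 1) ∧ (∀ z ∉ U, f z = 0) ∧
      ∀ Y : ∀ x, Γ.UnitTangent x, Γ.SmoothOn Y U → Γ.SmoothOn (fun z => f z • Y z) univ := by
  have := Γ.t2Space_base
  obtain ⟨f, -, hfU⟩ := (SmoothBumpFunction.nhds_basis_tsupport (I := 𝓘(ℝ, EM)) y).mem_iff.1
    (hU.mem_nhds hy)
  refine ⟨f, f.eventuallyEq_one, fun z hz => ?_, fun Y hY => ?_⟩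
  · by_contra h
    exact hz (hfU (subset_tsupport _ h))
  · intro x _
    by_cases hx : x ∈ U
    · exact ((hY.smul hU f.contMDiff).contMDiffAt (hU.mem_nhds hx)).contMDiffWithinAt
    · have hx' : ∀ᶠ z in 𝓝 x, f z = 0 := by
        have : (tsupport f)ᶜ ∈ 𝓝 x := (isClosed_tsupport _).isOpen_compl.mem_nhds
          (fun h => hx (hfU h))
        filter_upwards [this] with z hz using image_eq_zero_of_notMem_tsupport hz
      refine (contMDiffAt_tangent_iff.2 ⟨Γ.smooth_unit x, ?_⟩).contMDiffWithinAt
      refine (contMDiffAt_const (c := (0 : EG))).congr_of_eventuallyEq ?_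
      filter_upwards [hx'] with z hz
      refine Eq.trans ?_ (chartDeriv (Γ.unit x) (Γ.unit z)).map_zero
      exact congrArg _ ((congrArg (fun r : ℝ => r • (Y z : EG)) hz).trans (zero_smul ℝ (Y z : EG)))

/-- Every element of the Lie algebroid is the value of a global smooth section. -/
theorem exists_section_algebroid [FiniteDimensional ℝ EM] [T2Space G] (Γ : LieGroupoid EM EG M G)
    {y : M} {u : EG} (hu : Γ.dsrc (Γ.unit y) u = 0) :
    ∃ X : ∀ x, Γ.UnitTangent x, Γ.SmoothOn X univ ∧ (∀ x, X x ∈ Γ.algebroid x) ∧ X y = u := by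
  set e := Γ.unit y with he
  have hse : Γ.src e = y := Γ.src_unit y
  obtain ⟨σ, hσ, hsσ, hσs⟩ := (Γ.src_submersion.isSubmersionAt e).exists_section
  rw [hse] at hσ hsσ
  set φ := extChartAt 𝓘(ℝ, EG) e with hφ
  -- The constant field `u` of the chart, projected at each unit onto the tangent space of the
  -- source fibre by the retraction `σ (·, z)`.
  let X : M → EG := fun z => modelDeriv 𝓘(ℝ, EG) 𝓘(ℝ, EG)
    (fun b => σ (φ.symm b, z)) (φ (Γ.unit z)) u
  have hunit : ContinuousAt (fun z => (Γ.unit z, z)) y :=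
    Γ.smooth_unit.continuous.continuousAt.prodMk continuousAt_id
  have hsrc : ∀ᶠ z in 𝓝 y, Γ.unit z ∈ φ.source :=
    Γ.smooth_unit.continuous.continuousAt.eventually (extChartAt_source_mem_nhds e)
  have hdiff : ∀ z, Γ.unit z ∈ φ.source →
      ContMDiffAt (𝓘(ℝ, EG).prod 𝓘(ℝ, EM)) 𝓘(ℝ, EG) ∞ σ (Γ.unit z, z) →
      ContMDiffAt (𝓘(ℝ, EM).prod 𝓘(ℝ, EG)) 𝓘(ℝ, EG) ∞
        (Function.uncurry fun z b => σ (φ.symm b, z)) (z, φ (Γ.unit z)) := by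
    intro z hz hσz
    have h1 : ContMDiffAt 𝓘(ℝ, EG) 𝓘(ℝ, EG) ∞ φ.symm (φ (Γ.unit z)) :=
      (contMDiffOn_extChartAt_symm e).contMDiffAt
        ((isOpen_extChartAt_target e).mem_nhds (φ.map_source hz))
    have h2 : ContMDiffAt (𝓘(ℝ, EM).prod 𝓘(ℝ, EG)) (𝓘(ℝ, EG).prod 𝓘(ℝ, EM)) ∞
        (fun p : M × EG => (φ.symm p.2, p.1)) (z, φ (Γ.unit z)) :=
      (h1.comp (z, φ (Γ.unit z)) contMDiffAt_snd).prodMk contMDiffAt_fst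
    exact ContMDiffAt.comp_of_eq hσz h2 (by simp only [φ.left_inv hz])
  have hpartial : ∀ z, Γ.unit z ∈ φ.source →
      ContMDiffAt (𝓘(ℝ, EG).prod 𝓘(ℝ, EM)) 𝓘(ℝ, EG) ∞ σ (Γ.unit z, z) →
      MDifferentiableAt 𝓘(ℝ, EG) 𝓘(ℝ, EG) (fun b => σ (φ.symm b, z)) (φ (Γ.unit z)) := by
    intro z hz hσz
    exact ((hdiff z hz hσz).mdifferentiableAt (by simp)).comp (φ (Γ.unit z))
      (mdifferentiableAt_const.prodMk mdifferentiableAt_id)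
  have hline : ∀ b : EG, HasVelocity 𝓘(ℝ, EG) (fun t : ℝ => b + t • u) u := fun b => by
    rw [hasVelocity_iff_hasDerivAt]
    simpa using ((hasDerivAt_id (0 : ℝ)).smul_const u).const_add b
  have hgood : ∀ᶠ z in 𝓝 y, Γ.unit z ∈ φ.source ∧
      ContMDiffAt (𝓘(ℝ, EG).prod 𝓘(ℝ, EM)) 𝓘(ℝ, EG) ∞ σ (Γ.unit z, z) ∧
      (∀ᶠ p in 𝓝 (Γ.unit z, z), Γ.src (σ p) = p.2) ∧ σ (Γ.unit z, z) = Γ.unit z := by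
    have h1 : ∀ᶠ z in 𝓝 y, σ (Γ.unit z, Γ.src (Γ.unit z)) = Γ.unit z :=
      Γ.smooth_unit.continuous.continuousAt.eventually hσs
    filter_upwards [hsrc, hunit.eventually hσ, hunit.eventually hsσ.eventually_nhds, h1]
      with z h1 h2 h3 h4
    rw [Γ.src_unit] at h4
    exact ⟨h1, h2, h3, h4⟩
  obtain ⟨U, hUg, hU, hyU⟩ := eventually_nhds_iff.1 hgood
  have hXs : Γ.SmoothOn X U := by
    intro z hz
    obtain ⟨h1, h2, h3, h4⟩ := hUg z hz
    have hφz : ContMDiffAt 𝓘(ℝ, EM) 𝓘(ℝ, EG) ∞ (fun z => φ (Γ.unit z)) z :=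
      (contMDiffAt_extChartAt' (by simpa [φ] using h1)).comp z (Γ.smooth_unit z)
    have hc : ContMDiffAt 𝓘(ℝ, EM) 𝓘(ℝ, EG).tangent ∞
        (fun m => (⟨φ (Γ.unit m), u⟩ : TangentBundle 𝓘(ℝ, EG) EG)) z := by
      refine contMDiffAt_tangent_iff.2 ⟨hφz, ?_⟩
      simp only [chartDeriv_modelSpace]
      exact contMDiffAt_const (c := u)
    refine ((contMDiffAt_modelDeriv_apply (hdiff z h1 h2) hc).congr_of_eventuallyEq
      ?_).contMDiffWithinAt
    filter_upwards [hU.mem_nhds hz] with m hm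
    obtain ⟨h1, h2, h3, h4⟩ := hUg m hm
    rw [φ.left_inv h1, h4]
  have hXA : ∀ z ∈ U, X z ∈ Γ.algebroid z := by
    intro z hz
    obtain ⟨h1, h2, h3, h4⟩ := hUg z hz
    have v1 := (hline (φ (Γ.unit z))).comp (by simp) (hpartial z h1 h2)
    have v2 := hasVelocity_src (Γ := Γ) v1
    have h0 : σ (φ.symm (φ (Γ.unit z) + (0 : ℝ) • u), z) = Γ.unit z := by
      rw [zero_smul, add_zero, φ.left_inv h1, h4]
    rw [h0] at v2
    refine v2.unique ((HasVelocity.const z).congr ?_)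
    have hcont : ContinuousAt (fun t : ℝ => (φ.symm (φ (Γ.unit z) + t • u), z)) 0 := by
      have h5 : ContinuousAt φ.symm (φ (Γ.unit z)) :=
        continuousAt_extChartAt_symm'' (φ.map_source h1)
      have h6 : ContinuousAt (fun t : ℝ => φ (Γ.unit z) + t • u) 0 := by fun_prop
      exact (h5.comp_of_eq h6 (by simp)).prodMk continuousAt_const
    have h6 : ∀ᶠ p in 𝓝 (φ.symm (φ (Γ.unit z) + (0 : ℝ) • u), z), Γ.src (σ p) = p.2 := by
      rw [zero_smul, add_zero, φ.left_inv h1]; exact h3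
    exact hcont.eventually h6
  have hXy : X y = u := by
    obtain ⟨h1, h2, h3, h4⟩ := hUg y hyU
    have hσd : MDifferentiableAt (𝓘(ℝ, EG).prod 𝓘(ℝ, EM)) 𝓘(ℝ, EG) σ (e, y) :=
      h2.mdifferentiableAt (by simp)
    obtain ⟨c, hc0, hc⟩ := exists_hasVelocity e u
    have hsc : HasVelocity 𝓘(ℝ, EM) (fun t => Γ.src (c t)) 0 := by
      have := hasVelocity_src (Γ := Γ) hc
      rwa [hc0, hu] at this
    have hcs : ∀ᶠ g in 𝓝 (c 0), σ (g, Γ.src g) = g := by rwa [hc0]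
    -- Since `u` is killed by the derivative of the source, differentiating `σ (g, src g) = g` along
    -- `u` shows that the projection fixes `u`.
    have v1 := ((hc.prodMk hsc).comp (by simp only [hc0, hse]) hσd).congr
      (c' := c) (by filter_upwards [hc.continuousAt.eventually hcs] with t ht using ht.symm)
    have v2 := (hc.prodMk (HasVelocity.const y)).comp (by simp only [hc0]) hσd
    have v3 := (hasVelocity_iff_hasDerivAt.2 (hc.hasDerivAt_extChartAt hc0)).comp
      (by simp only [hc0]; rfl) (hpartial y h1 h2)
    have hcφ : ∀ᶠ g in 𝓝 (c 0), g ∈ φ.source := by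
      rw [hc0]; exact extChartAt_source_mem_nhds e
    refine (v3.unique (v2.congr ?_)).trans (v1.unique hc)
    filter_upwards [hc.continuousAt.eventually hcφ] with t ht
    rw [φ.left_inv ht]
  obtain ⟨f, hf1, hf0, hfX⟩ := Γ.exists_cutoff hU hyU
  refine ⟨fun z => f z • (X z : EG), hfX X hXs, fun z => ?_, ?_⟩
  · by_cases hz : z ∈ U
    · exact (Γ.algebroid z).smul_mem _ (hXA z hz)
    · have : f z • X z = 0 := by rw [hf0 z hz, zero_smul]
      exact (congrArg (· ∈ Γ.algebroid z) this).mpr (Γ.algebroid z).zero_mem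
  · change f y • X y = u
    rw [hf1.self_of_nhds, hXy, one_smul]

end LieGroupoid

/-! ### Invariance of an ideal near the units. -/

namespace LieGroupoid

variable {EM : Type*} [NormedAddCommGroup EM] [NormedSpace ℝ EM]
  {EG : Type*} [NormedAddCommGroup EG] [NormedSpace ℝ EG]
  {M : Type*} [TopologicalSpace M] [ChartedSpace EM M] [IsManifold 𝓘(ℝ, EM) ∞ M]
  {G : Type*} [TopologicalSpace G] [ChartedSpace EG G] [IsManifold 𝓘(ℝ, EG) ∞ G]
  {Γ : LieGroupoid EM EG M G} {I : ∀ x, Submodule ℝ (Γ.UnitTangent x)}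

theorem IsIdeal.mem_isotropy (hI : Γ.IsIdeal I) {x : M} {v : EG} (hv : v ∈ I x) :
    v ∈ Γ.isotropy x :=
  ⟨hI.le_algebroid x hv, hI.anchor_eq_zero x ⟨v, hI.le_algebroid x hv⟩ hv⟩

/-- Along a curve in a source fibre, the transport of a section of an ideal has derivative in the
transport of the ideal. -/
theorem IsIdeal.exists_hasDerivAt_Ad_inv [FiniteDimensional ℝ EM] [T2Space G] (hI : Γ.IsIdeal I)
    {U : Set M} (hU : IsOpen U) {Y : ∀ x, Γ.UnitTangent x} (hY : Γ.SmoothOn Y U)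
    (hYI : ∀ x ∈ U, Y x ∈ I x) {x : M} {c : ℝ → G} {ξ : EG} (hc : HasVelocity 𝓘(ℝ, EG) c ξ)
    (hs : ∀ᶠ t in 𝓝 0, Γ.src (c t) = x) (hcU : Γ.tgt (c 0) ∈ U) :
    ∃ b : EG, b ∈ I (Γ.tgt (c 0)) ∧
      HasDerivAt (fun t => Γ.Ad (Γ.inv (c t)) (Y (Γ.tgt (c t)))) (Γ.Ad (Γ.inv (c 0)) b) 0 := by
  set y := Γ.tgt (c 0) with hy
  have hcomp : ∀ᶠ t in 𝓝 0, Γ.src (c t) = Γ.tgt (Γ.inv (c 0)) := by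
    filter_upwards [hs] with t ht
    rw [ht, Γ.tgt_inv, hs.self_of_nhds]
  -- Right translation moves the curve to start at a unit, where the bracket formula applies; `c t =
  -- γ t · c 0` then contributes the fixed factor `Ad (inv (c 0))`.
  set γ : ℝ → G := fun t => Γ.mul (c t) (Γ.inv (c 0)) with hγdef
  have hγ := hasVelocity_mul hc (HasVelocity.const (Γ.inv (c 0))) hcomp
  set u := Γ.dmul (c 0) (Γ.inv (c 0)) (ξ, 0)
  have γ0 : γ 0 = Γ.unit y := Γ.mul_inv (c 0)
  have hγs : ∀ᶠ t in 𝓝 0, Γ.src (γ t) = y := by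
    filter_upwards [hcomp] with t ht
    simp only [hγdef]
    rw [Γ.src_mul _ _ ht, Γ.src_inv]
  have hγt : ∀ᶠ t in 𝓝 0, Γ.tgt (γ t) = Γ.tgt (c t) := by
    filter_upwards [hcomp] with t ht using Γ.tgt_mul _ _ ht
  have hu : Γ.dsrc (Γ.unit y) u = 0 := by
    have h1 := hasVelocity_src (Γ := Γ) (c := γ) hγ
    rw [γ0] at h1
    exact h1.unique ((HasVelocity.const y).congr hγs)
  obtain ⟨X, hX, hXA, hXy⟩ := Γ.exists_section_algebroid hu
  obtain ⟨f, hf1, hf0, hfY⟩ := Γ.exists_cutoff hU hcU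
  have hfYI : ∀ z, f z • Y z ∈ I z := fun z => by
    by_cases hz : z ∈ U
    · exact (I z).smul_mem _ (hYI z hz)
    · have : f z • Y z = 0 := (congrArg (fun r : ℝ => r • Y z) (hf0 z hz)).trans (zero_smul ℝ (Y z))
      exact (congrArg (· ∈ I z) this).mpr (I z).zero_mem
  have hD := hasDerivAt_Ad_inv (γ := γ) hX hXA (hfY Y hY) (fun z => hI.mem_isotropy (hfYI z)) γ0
    (hXy.symm ▸ hγ) hγs
  refine ⟨_, hI.bracket_mem X _ hX hXA (hfY Y hY) hfYI y, ?_⟩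
  have hD' := (Γ.Ad (Γ.inv (c 0))).hasFDerivAt.comp_hasDerivAt 0 hD
  refine hD'.congr_of_eventuallyEq ?_
  have htc : ContinuousAt (fun t => Γ.tgt (c t)) 0 :=
    (hasVelocity_tgt (Γ := Γ) hc).continuousAt
  filter_upwards [hs, hcomp, hγs, hγt, htc.eventually hf1, htc.eventually (hU.mem_nhds hcU)]
    with t h1 h2 h3 h4 h5 h6
  have hinv : Γ.inv (c t) = Γ.mul (Γ.inv (c 0)) (Γ.inv (γ t)) := by
    have hct : Γ.mul (γ t) (c 0) = c t :=
      Γ.inv_mul_cancel_right (h1.trans hs.self_of_nhds.symm)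
    rw [← Γ.inv_mul_rev h3, hct]
  have hval : (f (Γ.tgt (c t)) • Y (Γ.tgt (c t)) : EG) = Y (Γ.tgt (c t)) := by
    rw [h5, one_smul]
  have hmem : (Y (Γ.tgt (c t)) : EG) ∈ Γ.isotropy (Γ.src (Γ.inv (γ t))) := by
    rw [Γ.src_inv, h4]
    exact hI.mem_isotropy (hYI _ h6)
  have h7 : Γ.src (Γ.inv (c 0)) = Γ.tgt (Γ.inv (γ t)) := by rw [Γ.src_inv, Γ.tgt_inv, h3]
  simp only [Function.comp]
  rw [hinv, Ad_mul h7 hmem, h4]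
  exact congrArg (fun w => Γ.Ad (Γ.inv (c 0)) (Γ.Ad (Γ.inv (γ t)) w)) hval.symm

theorem IsSubbundle.exists_frame (hI : Γ.IsSubbundle I) (x : M) :
    ∃ U : Set M, IsOpen U ∧ x ∈ U ∧ ∃ (k : ℕ) (fr : Fin k → M → EG),
      (∀ i, Γ.SmoothOn (fr i) U) ∧ (∀ z ∈ U, LinearIndependent ℝ fun i => fr i z) ∧
      ∀ z ∈ U, ∀ b : EG, b ∈ I z ↔ ∃ a : Fin k → ℝ, ∑ i, a i • fr i z = b := by
  obtain ⟨U, hU, hxU, k, fr, hfr, hspan⟩ := hI x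
  refine ⟨U, hU, hxU, k, fr, hfr, fun z hz => (hspan z hz).1, fun z hz b => ?_⟩
  have h1 := (hspan z hz).2
  rw [← h1]
  exact Submodule.mem_span_range_iff_exists_fun (M := EG) ℝ

/-- The frame `fr` at the target of `g`, transported to the source of `g`. -/
noncomputable def transportFrame (Γ : LieGroupoid EM EG M G) {k : ℕ} (fr : Fin k → M → EG) (g : G) :
    (Fin k → ℝ) →L[ℝ] EG :=
  ∑ i, (ContinuousLinearMap.proj i : (Fin k → ℝ) →L[ℝ] ℝ).smulRight
    (Γ.Ad (Γ.inv g) (fr i (Γ.tgt g)))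

theorem transportFrame_apply {k : ℕ} (fr : Fin k → M → EG) (g : G) (a : Fin k → ℝ) :
    Γ.transportFrame fr g a = ∑ i, a i • Γ.Ad (Γ.inv g) (fr i (Γ.tgt g)) := by
  simp [transportFrame]

theorem transportFrame_apply_eq_Ad {k : ℕ} (fr : Fin k → M → EG) (g : G) (a : Fin k → ℝ) :
    Γ.transportFrame fr g a = Γ.Ad (Γ.inv g) (∑ i, a i • fr i (Γ.tgt g)) := by
  simp [transportFrame_apply]

/-- A smooth parametrization of a source fibre near the unit. -/
theorem exists_fibre_parametrization (Γ : LieGroupoid EM EG M G) (x : M) :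
    ∃ θ : EG → G, θ (extChartAt 𝓘(ℝ, EG) (Γ.unit x) (Γ.unit x)) = Γ.unit x ∧
      (∀ᶠ v in 𝓝 (extChartAt 𝓘(ℝ, EG) (Γ.unit x) (Γ.unit x)),
        ContMDiffAt 𝓘(ℝ, EG) 𝓘(ℝ, EG) ∞ θ v ∧ Γ.src (θ v) = x) ∧
      ∀ᶠ h in 𝓝 (Γ.unit x), Γ.src h = x → θ (extChartAt 𝓘(ℝ, EG) (Γ.unit x) h) = h := by
  set e := Γ.unit x with he
  have hse : Γ.src e = x := Γ.src_unit x
  obtain ⟨σ, hσ, hsσ, hσs⟩ := (Γ.src_submersion.isSubmersionAt e).exists_section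
  rw [hse] at hσ hsσ
  set φ := extChartAt 𝓘(ℝ, EG) e with hφ
  have hσe : σ (e, x) = e := by
    have := hσs.self_of_nhds
    rwa [hse] at this
  have hφsymm : ContinuousAt (fun v => (φ.symm v, x)) (φ e) :=
    (continuousAt_extChartAt_symm e).prodMk continuousAt_const
  have hφe : (φ.symm (φ e), x) = (e, x) := by simp [φ]
  refine ⟨fun v => σ (φ.symm v, x), (congrArg σ hφe).trans hσe, ?_, ?_⟩
  · have h1 : ∀ᶠ p in 𝓝 (φ.symm (φ e), x),
      ContMDiffAt (𝓘(ℝ, EG).prod 𝓘(ℝ, EM)) 𝓘(ℝ, EG) ∞ σ p ∧ Γ.src (σ p) = p.2 := by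
      rw [hφe]; exact hσ.and hsσ
    filter_upwards [hφsymm.eventually h1, extChartAt_target_mem_nhds e] with v hv hvt
    have h2 : ContMDiffAt 𝓘(ℝ, EG) 𝓘(ℝ, EG) ∞ φ.symm v :=
      (contMDiffOn_extChartAt_symm e).contMDiffAt ((isOpen_extChartAt_target e).mem_nhds hvt)
    exact ⟨ContMDiffAt.comp v hv.1 (h2.prodMk contMDiffAt_const), hv.2⟩
  · filter_upwards [hσs, extChartAt_source_mem_nhds (I := 𝓘(ℝ, EG)) e] with h h1 h2 hsh
    rw [φ.left_inv h2, ← hsh, h1]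

/-- With the source of `θ v` fixed, the transported frame vectors all lie in one tangent space, so
smoothness of the adjoint action becomes ordinary differentiability. -/
theorem differentiableAt_transportFrame {U : Set M} (hU : IsOpen U) {k : ℕ} {fr : Fin k → M → EG}
    (hfr : ∀ i, Γ.SmoothOn (fr i) U) (hiso : ∀ i, ∀ z ∈ U, fr i z ∈ Γ.isotropy z) {x : M}
    {θ : EG → G} {v : EG} (hθ : ContMDiffAt 𝓘(ℝ, EG) 𝓘(ℝ, EG) ∞ θ v)
    (hs : ∀ᶠ v in 𝓝 v, Γ.src (θ v) = x) (hv : Γ.tgt (θ v) ∈ U) :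
    DifferentiableAt ℝ (fun v => Γ.transportFrame fr (θ v)) v := by
  have hw : ∀ i, DifferentiableAt ℝ (fun v => Γ.Ad (Γ.inv (θ v)) (fr i (Γ.tgt (θ v)))) v := by
    intro i
    have h4 := contMDiffAt_chartDeriv_Ad hU (hfr i) (hiso i)
      (g := Γ.inv (θ v)) (by rwa [Γ.src_inv]) ((Γ.tgt_inv _).trans hs.self_of_nhds)
    have h5 : ContMDiffAt 𝓘(ℝ, EG) 𝓘(ℝ, EG) ∞ (fun v => Γ.inv (θ v)) v :=
      (Γ.smooth_inv (θ v)).comp v hθ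
    have h6 := (h4.comp v h5).contDiffAt.differentiableAt (by simp)
    refine h6.congr_of_eventuallyEq ?_
    filter_upwards [hs] with v' hv'
    simp only [Function.comp]
    rw [Γ.tgt_inv, hv', chartDeriv_self, Γ.src_inv]
    rfl
  refine DifferentiableAt.fun_sum fun i _ => ?_
  exact ((ContinuousLinearMap.smulRightL ℝ (Fin k → ℝ) EG
    (ContinuousLinearMap.proj i)).differentiableAt).comp v (hw i)

/-- Along each line, the derivative of a transported frame vector is the transport of some vector of
the ideal, and the frame spans the ideal. -/
theorem IsIdeal.fderiv_transportFrame_mem_range [FiniteDimensional ℝ EM] [T2Space G]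
    (hI : Γ.IsIdeal I) {U : Set M} (hU : IsOpen U) {k : ℕ} {fr : Fin k → M → EG}
    (hfr : ∀ i, Γ.SmoothOn (fr i) U)
    (hspan : ∀ z ∈ U, ∀ b : EG, b ∈ I z ↔ ∃ a : Fin k → ℝ, ∑ i, a i • fr i z = b)
    (hfrI : ∀ i, ∀ z ∈ U, fr i z ∈ I z) {x : M}
    {θ : EG → G} {v : EG} (hθ : ContMDiffAt 𝓘(ℝ, EG) 𝓘(ℝ, EG) ∞ θ v)
    (hs : ∀ᶠ v in 𝓝 v, Γ.src (θ v) = x) (hv : Γ.tgt (θ v) ∈ U)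
    (hd : DifferentiableAt ℝ (fun v => Γ.transportFrame fr (θ v)) v) (f : EG) (a : Fin k → ℝ) :
    fderiv ℝ (fun v => Γ.transportFrame fr (θ v)) v f a ∈ (Γ.transportFrame fr (θ v)).range := by
  have hline : HasDerivAt (fun t : ℝ => v + t • f) f 0 := by
    simpa using ((hasDerivAt_id (0 : ℝ)).smul_const f).const_add v
  have hv0 : v + (0 : ℝ) • f = v := by simp
  have hc := (hasVelocity_iff_hasDerivAt.2 hline).comp (f := θ) hv0 (hθ.mdifferentiableAt (by simp))
  have hlc : ∀ᶠ t : ℝ in 𝓝 0, Γ.src (θ (v + t • f)) = x := by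
    have h4 : ∀ᶠ v' in 𝓝 (v + (0 : ℝ) • f), Γ.src (θ v') = x := by rwa [hv0]
    exact hline.continuousAt.eventually h4
  have hb := fun i => hI.exists_hasDerivAt_Ad_inv hU (hfr i) (hfrI i) hc hlc
    (by rwa [hv0])
  simp only [hv0] at hb
  choose b hbI hbd using hb
  have hbd' : ∀ i, HasDerivAt
      (fun t : ℝ => Γ.Ad (Γ.inv (θ (v + t • f))) (fr i (Γ.tgt (θ (v + t • f)))))
      (Γ.Ad (Γ.inv (θ v)) (b i)) 0 := hbd
  have hd1 : HasDerivAt (fun t : ℝ => Γ.transportFrame fr (θ (v + t • f)) a)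
      (∑ i, a i • Γ.Ad (Γ.inv (θ v)) (b i)) 0 := by
    simp only [transportFrame_apply]
    have h1 : ∀ i, HasDerivAt
        (fun t : ℝ => a i • Γ.Ad (Γ.inv (θ (v + t • f))) (fr i (Γ.tgt (θ (v + t • f)))))
        (a i • Γ.Ad (Γ.inv (θ v)) (b i)) 0 := fun i => (hbd' i).const_smul (a i)
    exact HasDerivAt.fun_sum fun i _ => h1 i
  have hd2 : HasDerivAt (fun t : ℝ => Γ.transportFrame fr (θ (v + t • f)) a)
      (fderiv ℝ (fun v => Γ.transportFrame fr (θ v)) v f a) 0 :=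
    hd.hasDerivAt_line_apply f a
  rw [hd2.unique hd1]
  refine Submodule.sum_mem _ fun i _ => Submodule.smul_mem _ _ ?_
  obtain ⟨a', ha'⟩ := (hspan _ (by rwa [hv0]) (b i)).1 (hbI i)
  rw [hv0] at ha'
  exact ⟨a', by rw [← ha']; exact transportFrame_apply_eq_Ad fr (θ v) a'⟩

/-- The adjoint action of arrows near a unit preserves an ideal. -/
theorem IsIdeal.eventually_Ad_mem [FiniteDimensional ℝ EM] [FiniteDimensional ℝ EG] [T2Space G]
    (hI : Γ.IsIdeal I) (x : M) :
    ∀ᶠ h in 𝓝 (Γ.unit x), Γ.src h = x →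
      (∀ w : EG, w ∈ I (Γ.tgt h) → Γ.Ad (Γ.inv h) w ∈ I x) ∧
      (∀ v : EG, v ∈ I x → Γ.Ad h v ∈ I (Γ.tgt h)) := by
  obtain ⟨U, hU, hxU, k, fr, hfr, hli, hspan⟩ := hI.subbundle.exists_frame x
  obtain ⟨θ, hθe, hθ, hθφ⟩ := Γ.exists_fibre_parametrization x
  have hte : Γ.tgt (Γ.unit x) = x := Γ.tgt_unit x
  have hφc : ContinuousAt (extChartAt 𝓘(ℝ, EG) (Γ.unit x)) (Γ.unit x) :=
    continuousAt_extChartAt (Γ.unit x)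
  generalize extChartAt 𝓘(ℝ, EG) (Γ.unit x) = φ at hθe hθ hθφ hφc
  have hθU : ∀ᶠ v in 𝓝 (φ (Γ.unit x)), Γ.tgt (θ v) ∈ U := by
    have h1 : ContinuousAt (fun v => Γ.tgt (θ v)) (φ (Γ.unit x)) :=
      Γ.contMDiff_tgt.continuous.continuousAt.comp hθ.self_of_nhds.1.continuousAt
    refine h1.eventually (hU.mem_nhds ?_)
    beta_reduce
    rwa [hθe, hte]
  have hfrI : ∀ i, ∀ z ∈ U, fr i z ∈ I z := fun i z hz =>
    (hspan z hz (fr i z)).2 ⟨Pi.single i 1, by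
      simp [Pi.single_apply]⟩
  have hgood := (hθ.and hθU).eventually_nhds
  have hWd : ∀ᶠ v in 𝓝 (φ (Γ.unit x)),
      DifferentiableAt ℝ (fun v => Γ.transportFrame fr (θ v)) v := by
    filter_upwards [hgood] with v hv
    exact differentiableAt_transportFrame hU hfr (fun i z hz => hI.mem_isotropy (hfrI i z hz))
      hv.self_of_nhds.1.1 (hv.mono fun _ h => h.1.2) hv.self_of_nhds.2
  have hWd' : ∀ᶠ v in 𝓝 (φ (Γ.unit x)), ∀ f a,
      fderiv ℝ (fun v => Γ.transportFrame fr (θ v)) v f a ∈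
        (Γ.transportFrame fr (θ v)).range := by
    filter_upwards [hgood, hWd] with v hv hWv f a
    exact hI.fderiv_transportFrame_mem_range hU hfr hspan hfrI
      hv.self_of_nhds.1.1 (hv.mono fun _ h => h.1.2) hv.self_of_nhds.2 hWv f a
  have hWe : ∀ a, Γ.transportFrame fr (Γ.unit x) a = ∑ i, a i • fr i x := fun a => by
    rw [transportFrame_apply]
    refine Finset.sum_congr rfl fun i _ => congrArg (a i • ·) ?_
    rw [hte, Γ.inv_unit]
    exact Ad_unit (EG := EG) (hI.mem_isotropy (hfrI i x hxU))
  have hinj : Function.Injective (Γ.transportFrame fr (θ (φ (Γ.unit x)))) := by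
    rw [hθe]
    refine (injective_iff_map_eq_zero _).2 fun a ha => ?_
    rw [hWe] at ha
    exact funext fun i => Fintype.linearIndependent_iff.1 (hli x hxU) a ha i
  have hrange := eventually_range_eq_of_fderiv_mem_range 
    (W := fun v => Γ.transportFrame fr (θ v)) hinj hWd hWd'
  simp only [hθe] at hrange
  have hrange0 : ∀ b : EG, b ∈ I x ↔ b ∈ (Γ.transportFrame fr (Γ.unit x)).range := fun b => by
    rw [hspan x hxU b]
    exact exists_congr fun a => (congrArg (· = b) (hWe a)).symm.to_iff
  filter_upwards [hθφ, hφc.eventually hrange, hφc.eventually hθU] with h h1 h3 h5 hsh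
  rw [h1 hsh] at h3 h5
  constructor
  · intro b hb
    obtain ⟨a, rfl⟩ := (hspan _ h5 b).1 hb
    rw [hrange0, ← h3, ← transportFrame_apply_eq_Ad]
    exact ⟨a, rfl⟩
  -- Equality of the ranges, and not just an inclusion, is needed here: `b` is the transport of some
  -- vector of the ideal at the target of `h`, and `Ad h` recovers that vector.
  · intro b hb
    rw [hrange0, ← h3] at hb
    obtain ⟨a, ha⟩ := hb
    have ha' : Γ.transportFrame fr h a = b := ha
    have h6 : (∑ i, a i • fr i (Γ.tgt h)) ∈ I (Γ.tgt h) := (hspan _ h5 _).2 ⟨a, rfl⟩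
    rw [← ha', transportFrame_apply_eq_Ad, Ad_Ad_inv (hI.mem_isotropy h6)]
    exact h6

end LieGroupoid

/-! ### Invariance under all arrows and the resulting representation. -/

namespace LieGroupoid

variable {EM : Type*} [NormedAddCommGroup EM] [NormedSpace ℝ EM]
  {EG : Type*} [NormedAddCommGroup EG] [NormedSpace ℝ EG]
  {M : Type*} [TopologicalSpace M] [ChartedSpace EM M] [IsManifold 𝓘(ℝ, EM) ∞ M]
  {G : Type*} [TopologicalSpace G] [ChartedSpace EG G] [IsManifold 𝓘(ℝ, EG) ∞ G]
  {Γ : LieGroupoid EM EG M G} {I : ∀ x, Submodule ℝ (Γ.UnitTangent x)}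

/-- Carries neighbourhoods of `g₀` in its source fibre to neighbourhoods of a unit, so that local
invariance at units can be used at any arrow. -/
theorem tendsto_mul_inv (Γ : LieGroupoid EM EG M G) (g₀ : G) :
    Filter.Tendsto (fun g => Γ.mul g (Γ.inv g₀)) (𝓝[Γ.src ⁻¹' {Γ.src g₀}] g₀)
      (𝓝 (Γ.unit (Γ.tgt g₀))) := by
  have h1 := (Γ.smooth_mul (g₀, Γ.inv g₀) (Γ.tgt_inv g₀).symm).continuousWithinAt
  have h2 : Filter.Tendsto (fun g => (g, Γ.inv g₀)) (𝓝[Γ.src ⁻¹' {Γ.src g₀}] g₀)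
      (𝓝[{p : G × G | Γ.src p.1 = Γ.tgt p.2}] (g₀, Γ.inv g₀)) := by
    refine tendsto_nhdsWithin_iff.2 ⟨?_, ?_⟩
    · exact (continuous_id.prodMk continuous_const).continuousAt.tendsto.mono_left
        nhdsWithin_le_nhds
    · filter_upwards [self_mem_nhdsWithin] with g hg
      exact Eq.trans hg (Γ.tgt_inv g₀).symm
  have h3 := h1.tendsto.comp h2
  rwa [Γ.mul_inv] at h3

/-- The adjoint action of a source connected groupoid preserves every ideal. -/
theorem IsIdeal.Ad_mem [FiniteDimensional ℝ EM] [FiniteDimensional ℝ EG] [T2Space G]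
    (hI : Γ.IsIdeal I) (hconn : ∀ x, IsConnected (Γ.src ⁻¹' {x})) (g : G) {v : EG}
    (hv : v ∈ I (Γ.src g)) : Γ.Ad g v ∈ I (Γ.tgt g) := by
  classical
  let P : G → Prop := fun g => ∀ v : EG, v ∈ I (Γ.src g) → Γ.Ad g v ∈ I (Γ.tgt g)
  -- Write $g=hg_0$ with $h$ near a unit. Both `Ad h` and `Ad (inv h)` preserve the ideal, so
  -- invariance is an open and closed condition on the source fibre.
  have hloc : ∀ g₀, ∀ᶠ g in 𝓝[Γ.src ⁻¹' {Γ.src g₀}] g₀, P g ↔ P g₀ := by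
    intro g₀
    filter_upwards [(Γ.tendsto_mul_inv g₀).eventually (hI.eventually_Ad_mem (Γ.tgt g₀)),
      self_mem_nhdsWithin] with g hg hs
    have hs' : Γ.src g = Γ.src g₀ := hs
    have hc : Γ.src g = Γ.tgt (Γ.inv g₀) := hs'.trans (Γ.tgt_inv g₀).symm
    have hsh : Γ.src (Γ.mul g (Γ.inv g₀)) = Γ.tgt g₀ := (Γ.src_mul _ _ hc).trans (Γ.src_inv g₀)
    have hth : Γ.tgt (Γ.mul g (Γ.inv g₀)) = Γ.tgt g := Γ.tgt_mul _ _ hc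
    have hgm : Γ.mul (Γ.mul g (Γ.inv g₀)) g₀ = g := Γ.inv_mul_cancel_right hs'
    obtain ⟨h1, h2⟩ := hg hsh
    generalize Γ.mul g (Γ.inv g₀) = h at hsh hth hgm h1 h2
    have hmul : ∀ v : EG, v ∈ I (Γ.src g₀) → Γ.Ad g v = Γ.Ad h (Γ.Ad g₀ v) := fun v hv => by
      rw [← hgm]
      exact Ad_mul hsh (hI.mem_isotropy hv)
    rw [hth] at h1 h2
    constructor
    · intro hP v hv
      have h3 : Γ.Ad g v ∈ I (Γ.tgt g) := hP v (by rwa [hs'])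
      rw [hmul v hv] at h3
      have h4 := h1 _ h3
      rwa [Ad_inv_Ad] at h4
      rw [hsh]
      exact LieGroupoid.Ad_mem (hI.mem_isotropy hv)
    · intro hP v hv
      rw [hs'] at hv
      rw [hmul v hv]
      exact h2 _ (hP v hv)
  have hcont : ContinuousOn (fun g => decide (P g)) (Γ.src ⁻¹' {Γ.src g}) := by
    intro g₀ hg₀
    have h1 : Γ.src g₀ = Γ.src g := hg₀
    have h2 := hloc g₀
    rw [h1] at h2
    refine (continuousWithinAt_const (b := decide (P g₀))).congr_of_eventuallyEq ?_ rfl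
    filter_upwards [h2] with g' hg'
    simp only [hg']
  have hPu : P (Γ.unit (Γ.src g)) := by
    intro v hv
    rw [Γ.src_unit] at hv
    rw [Γ.tgt_unit, Ad_unit (hI.mem_isotropy hv)]
    exact hv
  have := (hconn (Γ.src g)).isPreconnected.constant hcont (x := g) (y := Γ.unit (Γ.src g)) rfl
    (Γ.src_unit _)
  exact (decide_eq_decide.1 this).2 hPu v hv

/-- The adjoint representation of a source connected groupoid on an ideal. -/
noncomputable def IsIdeal.representation [FiniteDimensional ℝ EM] [FiniteDimensional ℝ EG]
    [T2Space G] (hI : Γ.IsIdeal I) (hconn : ∀ x, IsConnected (Γ.src ⁻¹' {x})) :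
    Γ.Representation I where
  act {x y} g hs ht :=
    { toFun := fun v => ⟨Γ.Ad g (v.1 : EG), by
        subst hs ht
        exact hI.Ad_mem hconn g v.2⟩
      map_add' := fun v w => Subtype.ext ((Γ.Ad g).map_add v.1 w.1)
      map_smul' := fun r v => Subtype.ext ((Γ.Ad g).map_smul r v.1) }
  act_unit x := LinearMap.ext fun v => Subtype.ext (Ad_unit (EG := EG) (hI.mem_isotropy v.2))
  act_mul g h hgs hgt hhs hht := LinearMap.ext fun v => Subtype.ext (by
    subst hhs
    exact Ad_mul (EG := EG) (hgs.trans hht.symm) (hI.mem_isotropy v.2))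
  smooth U hU Y hY g hg :=
    (contMDiffAt_Ad (EG := EG) hU hY (fun z _ => hI.mem_isotropy (Y z).2) hg).contMDiffWithinAt

theorem IsIdeal.representation_integrates [FiniteDimensional ℝ EM] [FiniteDimensional ℝ EG]
    [T2Space G] (hI : Γ.IsIdeal I) (hconn : ∀ x, IsConnected (Γ.src ⁻¹' {x})) :
    (hI.representation hconn).Integrates Γ.bracket := by
  intro X hX hXA Y hY x γ h0 hs hγ
  refine hasDerivAt_Ad_inv hX hXA hY (fun z => hI.mem_isotropy (Y z).2) h0 ?_ (.of_forall hs)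
  -- Of the integral curve only its velocity at time `0` is used.
  have h1 : HasVelocity 𝓘(ℝ, EG) γ (Γ.rightInvariant X (γ 0)) := hγ.self_of_nhds
  rwa [h0, rightInvariant_unit (hXA x)] at h1

end LieGroupoid

theorem mainTheorem10
    {EM : Type*} [NormedAddCommGroup EM] [NormedSpace ℝ EM] [FiniteDimensional ℝ EM]
    {EG : Type*} [NormedAddCommGroup EG] [NormedSpace ℝ EG] [FiniteDimensional ℝ EG]
    {M : Type*} [TopologicalSpace M] [ChartedSpace EM M] [IsManifold 𝓘(ℝ, EM) ∞ M]
    {G : Type*} [TopologicalSpace G] [ChartedSpace EG G] [IsManifold 𝓘(ℝ, EG) ∞ G] [T2Space G]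
    (Γ : LieGroupoid EM EG M G)
    (hconn : ∀ x, IsConnected (Γ.src ⁻¹' {x}))
    (I : ∀ x, Submodule ℝ (Γ.UnitTangent x)) (hI : Γ.IsIdeal I) :
    ∃ R : Γ.Representation I, R.Integrates Γ.bracket :=
  ⟨hI.representation hconn, hI.representation_integrates hconn⟩
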